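/- Let $\mathbf{Loc}$ be the category of locales, ordered by $f\le g$ iff $f^*v\le g^*v$ for all opens $v$, and let $\mathbb{S}$ be the Sierpiński locale, so that morphisms $B\to\mathbb{S}$ correspond to opens of $B$ (equivalently, by complementation, to closed sublocales of $B$). Write $\vee$ for the internal join $\mathbb{S}\times\mathbb{S}\to\mathbb{S}$ and for the induced operations on $\mathbb{S}^Y$, and $\bot\colon 1\to\mathbb{S}^1$ for the bottom point. Let $X$ be a compact Hausdorff locale, that is, $X$ is compact and the diagonal $X\to X\times X$ is proper (a closed sublocale). Then $X$ admits a dual presentation with generators $[=x]$ for $x\in X$ and relations $[=x]\wedge[=y]\vdash x=y$ for $x,y\in X$ and $\top\vdash\bigvee_{x\in X}[=x]$. Explicitly: 1. The locales $X$, $X\times X$ and $1$ indexing the generators and relations are compact Hausdorff, and the exponentials $\mathbb{S}^X$, $\mathbb{S}^{X\times X}$ and $\mathbb{S}^1$ exist in $\mathbf{Loc}$. 2. For any choice of these exponentials, let $i\colon X\to\mathbb{S}^X$ and $d\colon 1\to\mathbb{S}^{X\times X}$ be the exponential transposes of the morphism $X\times X\to\mathbb{S}$ (respectively $1\times X\times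 X\to\mathbb{S}$) corresponding to the closed diagonal of $X$. The morphism $\mathbb{S}^{!}\colon\mathbb{S}^1\to\mathbb{S}^X$ has a right adjoint $(\mathbb{S}^{!})_*\colon\mathbb{S}^X\to\mathbb{S}^1$, and this corresponds to taking images of closeds: if $h\colon A\to\mathbb{S}^X$ classifies the open $u$ of $A\times X$, then $(\mathbb{S}^{!})_*\circ h$ classifies $p_*(u)$, where $p=A\times{!}\colon A\times X\to A\times 1$ and $p_*$ is the right adjoint of $p^*$. 3. The morphism $i$ is the inserter of $$(d\circ{!},\,(\mathbb{S}^{!})_*)\;\le\;(\mathbb{S}^{\pi_1}\vee\mathbb{S}^{\pi_2},\,\bot\circ{!})\colon\ \mathbb{S}^X\rightrightarrows\mathbb{S}^{X\times X}\times\mathbb{S}^1 .$$ That is, writing $g$ and $f$ for the left-hand and right-hand morphisms: $g\circ i\le f\circ i$; every $h\colon A\to\mathbb{S}^X$ with $g\circ h\le f\circ h$ factors uniquely as $h=i\circ k$ with $k\colon A\to X$; and for $k,k'\colon A\to X$, $i\circ k\le i\circ k'$ implies $k\le k'$. -/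

import Mathlib

open CategoryTheory MonoidalCategory CartesianMonoidalCategory

universe u

namespace CompactHausdorffLocale

/-! ## Locale morphisms, their inverse and direct images, and their order -/

/-- The locale morphism given by a frame homomorphism in the opposite direction. -/
def ofFrameHom {X Y : Locale.{u}} (φ : FrameHom Y X) : X ⟶ Y :=
  Quiver.Hom.op (Frm.ofHom φ)

/-- The frame homomorphism `f^* : O Y → O X` of a locale morphism `f : X ⟶ Y`. -/
def inverseImage {X Y : Locale.{u}} (f : X ⟶ Y) : FrameHom Y X :=
  f.unop.hom

theorem inverseImage_ofFrameHom {X Y : Locale.{u}} (φ : FrameHom Y X) :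
    inverseImage (ofFrameHom φ) = φ := rfl

theorem inverseImage_comp {X Y Z : Locale.{u}} (f : X ⟶ Y) (g : Y ⟶ Z) (w : Z) :
    inverseImage (f ≫ g) w = inverseImage f (inverseImage g w) := rfl

theorem locale_hom_ext {X Y : Locale.{u}} {f g : X ⟶ Y}
    (h : ∀ v : Y, inverseImage f v = inverseImage g v) : f = g :=
  Quiver.Hom.unop_inj (Frm.ext h)

/-- The pointwise order on locale morphisms: `f ≤ g` iff `f^* v ≤ g^* v` for every open `v`. -/
instance homPartialOrder (X Y : Locale.{u}) : PartialOrder (X ⟶ Y) where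
  le f g := ∀ v : Y, inverseImage f v ≤ inverseImage g v
  le_refl _ _ := le_rfl
  le_trans _ _ _ h₁ h₂ v := (h₁ v).trans (h₂ v)
  le_antisymm _ _ h₁ h₂ := locale_hom_ext fun v => le_antisymm (h₁ v) (h₂ v)

/-- The right adjoint `f_* : O X → O Y` of `f^*`. In terms of closed sublocales (complements of
opens) it sends a closed sublocale of `X` to the closure of its image in `Y`. -/
def directImage {X Y : Locale.{u}} (f : X ⟶ Y) (a : X) : Y :=
  sSup {v : Y | inverseImage f v ≤ a}

theorem le_directImage_iff {X Y : Locale.{u}} (f : X ⟶ Y) (a : X) (v : Y) :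
    v ≤ directImage f a ↔ inverseImage f v ≤ a := by
  constructor
  · intro h
    refine (OrderHomClass.mono (inverseImage f) h).trans ?_
    unfold directImage
    rw [map_sSup]
    refine sSup_le ?_
    rintro _ ⟨w, hw, rfl⟩
    exact hw
  · intro h
    exact le_sSup h

/-- `f` is proper: `f_*` preserves directed joins and satisfies Frobenius reciprocity. -/
structure IsProperMap {X Y : Locale.{u}} (f : X ⟶ Y) : Prop where
  directed : ∀ s : Set X, s.Nonempty → DirectedOn (· ≤ ·) s →
    directImage f (sSup s) = sSup (directImage f '' s)
  frobenius : ∀ (v : Y) (a : X), directImage f (inverseImage f v ⊔ a) = v ⊔ directImage f a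

/-! ## Finite products of locales -/

/-- The frame of opens of the product of two locales: the lower sets `U` of `A × B` such that
`(⋁ s, b) ∈ U` whenever `(a, b) ∈ U` for all `a ∈ s`, and symmetrically in the other variable. -/
def prodFrame (A B : Type u) [Order.Frame A] [Order.Frame B] : Sublocale (LowerSet (A × B)) where
  carrier := {U | (∀ (s : Set A) (b : B), (∀ a ∈ s, (a, b) ∈ U) → (sSup s, b) ∈ U) ∧
    (∀ (a : A) (t : Set B), (∀ b ∈ t, (a, b) ∈ U) → (a, sSup t) ∈ U)}
  sInf_mem' S hS := by
    refine ⟨fun s b h => ?_, fun a t h => ?_⟩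
    · simp only [LowerSet.mem_sInf_iff] at h ⊢
      exact fun U hU => (hS hU).1 s b fun a ha => h a ha U hU
    · simp only [LowerSet.mem_sInf_iff] at h ⊢
      exact fun U hU => (hS hU).2 a t fun b hb => h b hb U hU
  himp_mem' U V hV := by
    have key : ∀ p : A × B, p ∈ (U ⇨ V) ↔ ∀ q ≤ p, q ∈ U → q ∈ V := by
      intro p
      rw [← LowerSet.Iic_le, le_himp_iff]
      constructor
      · intro h q hq hqU
        exact h (show q ∈ LowerSet.Iic p ⊓ U from ⟨hq, hqU⟩)
      · intro h q hq
        exact h q hq.1 hq.2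
    refine ⟨fun s b h => ?_, fun a t h => ?_⟩
    · rw [key]
      rintro ⟨x, y⟩ ⟨hx, hy⟩ hU
      have hx' : x = sSup ((fun a => x ⊓ a) '' s) := by
        rw [sSup_image, ← inf_sSup_eq]
        exact (inf_eq_left.2 hx).symm
      rw [hx']
      refine hV.1 _ _ ?_
      rintro _ ⟨a, ha, rfl⟩
      exact (key _).1 (h a ha) _ ⟨inf_le_right, hy⟩ (U.lower
        (show (x ⊓ a, y) ≤ (x, y) from ⟨inf_le_left, le_rfl⟩) hU)
    · rw [key]
      rintro ⟨x, y⟩ ⟨hx, hy⟩ hU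
      have hy' : y = sSup ((fun b => y ⊓ b) '' t) := by
        rw [sSup_image, ← inf_sSup_eq]
        exact (inf_eq_left.2 hy).symm
      rw [hy']
      refine hV.2 _ _ ?_
      rintro _ ⟨b, hb, rfl⟩
      exact (key _).1 (h b hb) _ ⟨hx, inf_le_right⟩ (U.lower
        (show (x, y ⊓ b) ≤ (x, y) from ⟨le_rfl, inf_le_left⟩) hU)

section Product

variable {A B C : Type u} [Order.Frame A] [Order.Frame B] [Order.Frame C]

theorem restrict_le_iff (p : A × B) (W : prodFrame A B) :
    (prodFrame A B).restrict (LowerSet.Iic p) ≤ W ↔ p ∈ W.1 := by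
  rw [(prodFrame A B).giRestrict.gc.le_iff_le]
  exact LowerSet.Iic_le

/-- `a ↦ a × B`, the inverse image map of the first projection. -/
def prodInl (A B : Type u) [Order.Frame A] [Order.Frame B] : FrameHom A (prodFrame A B) where
  toFun a := (prodFrame A B).restrict (LowerSet.Iic (a, ⊤))
  map_inf' a a' := by
    rw [← map_inf, ← LowerSet.Iic_inf, Prod.mk_inf_mk, inf_top_eq]
  map_top' := by
    rw [← map_top (prodFrame A B).restrict]
    exact congrArg _ LowerSet.Iic_top
  map_sSup' s := by
    refine eq_of_forall_ge_iff fun W => ?_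
    rw [restrict_le_iff, sSup_le_iff, Set.forall_mem_image]
    constructor
    · intro h a ha
      rw [restrict_le_iff]
      exact W.1.lower (show (a, (⊤ : B)) ≤ (sSup s, ⊤) from ⟨le_sSup ha, le_rfl⟩) h
    · intro h
      exact W.2.1 s ⊤ fun a ha => (restrict_le_iff _ W).1 (h ha)

/-- `b ↦ A × b`, the inverse image map of the second projection. -/
def prodInr (A B : Type u) [Order.Frame A] [Order.Frame B] : FrameHom B (prodFrame A B) where
  toFun b := (prodFrame A B).restrict (LowerSet.Iic (⊤, b))
  map_inf' a a' := by
    rw [← map_inf, ← LowerSet.Iic_inf, Prod.mk_inf_mk, inf_top_eq]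
  map_top' := by
    rw [← map_top (prodFrame A B).restrict]
    exact congrArg _ LowerSet.Iic_top
  map_sSup' s := by
    refine eq_of_forall_ge_iff fun W => ?_
    rw [restrict_le_iff, sSup_le_iff, Set.forall_mem_image]
    constructor
    · intro h a ha
      rw [restrict_le_iff]
      exact W.1.lower (show ((⊤ : A), a) ≤ (⊤, sSup s) from ⟨le_rfl, le_sSup ha⟩) h
    · intro h
      exact W.2.2 ⊤ s fun a ha => (restrict_le_iff _ W).1 (h ha)

theorem prodInl_inf_prodInr (p : A × B) :
    prodInl A B p.1 ⊓ prodInr A B p.2 = (prodFrame A B).restrict (LowerSet.Iic p) := by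
  change (prodFrame A B).restrict _ ⊓ (prodFrame A B).restrict _ = _
  rw [← map_inf, ← LowerSet.Iic_inf, Prod.mk_inf_mk, inf_top_eq, top_inf_eq]

theorem prodFrame_eq_iSup (W : prodFrame A B) :
    W = ⨆ p ∈ W.1, prodInl A B p.1 ⊓ prodInr A B p.2 := by
  refine eq_of_forall_ge_iff fun V => ?_
  simp only [prodInl_inf_prodInr, iSup_le_iff, restrict_le_iff]
  exact Iff.rfl

/-- The opens of the product that are mapped below `c` by the copairing of `f` and `g`. -/
def prodDescAdj (f : FrameHom A C) (g : FrameHom B C) (c : C) : prodFrame A B where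
  val := ⟨{p | f p.1 ⊓ g p.2 ≤ c}, fun _ _ h hp =>
    (inf_le_inf (OrderHomClass.mono f h.1) (OrderHomClass.mono g h.2)).trans hp⟩
  property := by
    refine ⟨fun s b h => ?_, fun a t h => ?_⟩
    · change f (sSup s) ⊓ g b ≤ c
      rw [map_sSup, sSup_inf_eq]
      refine iSup₂_le ?_
      rintro _ ⟨a, ha, rfl⟩
      exact h a ha
    · change f a ⊓ g (sSup t) ≤ c
      rw [map_sSup, inf_sSup_eq]
      refine iSup₂_le ?_
      rintro _ ⟨b, hb, rfl⟩
      exact h b hb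

theorem prodDesc_gc (f : FrameHom A C) (g : FrameHom B C) :
    GaloisConnection (fun W : prodFrame A B => ⨆ p ∈ W.1, f p.1 ⊓ g p.2) (prodDescAdj f g) := by
  intro W c
  simp only [iSup_le_iff]
  exact Iff.rfl

/-- The copairing of two frame homomorphisms out of the frame of opens of a product. -/
def prodDesc (f : FrameHom A C) (g : FrameHom B C) : FrameHom (prodFrame A B) C where
  toFun W := ⨆ p ∈ W.1, f p.1 ⊓ g p.2
  map_inf' W V := by
    refine le_antisymm (le_inf ((prodDesc_gc f g).monotone_l inf_le_left)
      ((prodDesc_gc f g).monotone_l inf_le_right)) ?_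
    simp only [iSup_inf_eq, inf_iSup_eq]
    refine iSup₂_le fun q hq => iSup₂_le fun p hp => ?_
    refine le_trans ?_ (le_iSup₂_of_le (p ⊓ q)
      ⟨W.1.lower inf_le_left hp, V.1.lower inf_le_right hq⟩ le_rfl)
    simp only [Prod.fst_inf, Prod.snd_inf, map_inf]
    apply le_of_eq
    ac_rfl
  map_top' := by
    refine le_antisymm le_top (le_iSup₂_of_le (⊤, ⊤) ?_ (by simp))
    trivial
  map_sSup' s := by
    rw [(prodDesc_gc f g).l_sSup, sSup_image]

theorem prodDesc_inl (f : FrameHom A C) (g : FrameHom B C) (a : A) :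
    prodDesc f g (prodInl A B a) = f a := by
  refine eq_of_forall_ge_iff fun c => ?_
  refine ((prodDesc_gc f g).le_iff_le).trans ((restrict_le_iff _ _).trans ?_)
  change f a ⊓ g ⊤ ≤ c ↔ _
  rw [map_top, inf_top_eq]

theorem prodDesc_inr (f : FrameHom A C) (g : FrameHom B C) (b : B) :
    prodDesc f g (prodInr A B b) = g b := by
  refine eq_of_forall_ge_iff fun c => ?_
  refine ((prodDesc_gc f g).le_iff_le).trans ((restrict_le_iff _ _).trans ?_)
  change f ⊤ ⊓ g b ≤ c ↔ _
  rw [map_top, top_inf_eq]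

theorem prodFrame_hom_ext {φ ψ : FrameHom (prodFrame A B) C}
    (h₁ : ∀ a, φ (prodInl A B a) = ψ (prodInl A B a))
    (h₂ : ∀ b, φ (prodInr A B b) = ψ (prodInr A B b)) (W : prodFrame A B) : φ W = ψ W := by
  rw [prodFrame_eq_iSup W]
  simp only [map_iSup, map_inf, h₁, h₂]

end Product

/-- The binary product of locales, with its projections. -/
def prodCone (X Y : Locale.{u}) : Limits.BinaryFan X Y :=
  Limits.BinaryFan.mk (P := Locale.of (prodFrame X Y))
    (ofFrameHom (prodInl X Y)) (ofFrameHom (prodInr X Y))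

/-- It has the universal property of the product. -/
def prodConeIsLimit (X Y : Locale.{u}) : Limits.IsLimit (prodCone X Y) :=
  Limits.BinaryFan.IsLimit.mk _
    (fun f g => ofFrameHom (prodDesc (inverseImage f) (inverseImage g)))
    (fun f g => locale_hom_ext fun a => prodDesc_inl (inverseImage f) (inverseImage g) a)
    (fun f g => locale_hom_ext fun b => prodDesc_inr (inverseImage f) (inverseImage g) b)
    (fun f g m h₁ h₂ => locale_hom_ext fun W => by
      refine prodFrame_hom_ext (φ := inverseImage m) (fun a => ?_) (fun b => ?_) W
      · have hm : inverseImage m (prodInl X Y a) = inverseImage f a := by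
          rw [← h₁]
          rfl
        exact hm.trans (prodDesc_inl (inverseImage f) (inverseImage g) a).symm
      · have hm : inverseImage m (prodInr X Y b) = inverseImage g b := by
          rw [← h₂]
          rfl
        exact hm.trans (prodDesc_inr (inverseImage f) (inverseImage g) b).symm)

/-- The one-point locale, whose opens are the subsets of a singleton. -/
def pointLocale : Locale.{u} := Locale.of (Set PUnit.{u + 1})

/-- The inverse image map of the unique morphism to the one-point locale. -/
def pointDesc (C : Type u) [Order.Frame C] : FrameHom (Set PUnit.{u + 1}) C where
  toFun U := ⨆ _ : PUnit.unit ∈ U, ⊤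
  map_inf' U V := by
    by_cases h₁ : PUnit.unit ∈ U <;> by_cases h₂ : PUnit.unit ∈ V <;> simp [h₁, h₂]
  map_top' := by simp
  map_sSup' s := by
    refine eq_of_forall_ge_iff fun c => ?_
    simp only [iSup_le_iff, sSup_le_iff, Set.forall_mem_image]
    constructor
    · intro h U hU hx
      exact h ⟨U, hU, hx⟩
    · rintro h ⟨U, hU, hx⟩
      exact h hU hx

/-- The one-point locale is terminal. -/
def pointLocaleIsTerminal : Limits.IsTerminal pointLocale.{u} :=
  Limits.IsTerminal.ofUniqueHom (fun X => ofFrameHom (pointDesc X)) fun X m =>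
    locale_hom_ext fun U => by
      change inverseImage m U = pointDesc X U
      rcases Set.eq_empty_or_nonempty U with h | ⟨x, hx⟩
      · have hU : U = (⊥ : Set PUnit) := h
        rw [hU]
        exact (map_bot (inverseImage m)).trans (map_bot (pointDesc X)).symm
      · have hU : U = (⊤ : Set PUnit) := Set.eq_univ_of_forall fun y => hx
        rw [hU]
        exact (map_top (inverseImage m)).trans (map_top (pointDesc X)).symm

/-- Finite products of locales: `X ⊗ Y` is the product `X × Y` and `𝟙_ Locale` is the
terminal locale `1`. -/
instance localeCartesian : CartesianMonoidalCategory Locale.{u} :=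
  CartesianMonoidalCategory.ofChosenFiniteProducts
    ⟨Limits.asEmptyCone pointLocale, pointLocaleIsTerminal⟩
    fun X Y => ⟨prodCone X Y, prodConeIsLimit X Y⟩

/-! ## Compact Hausdorff locales -/

/-- A directed family of opens with join `⊤` contains `⊤`. -/
def IsCompactLocale (X : Locale.{u}) : Prop :=
  ∀ s : Set X, s.Nonempty → DirectedOn (· ≤ ·) s → sSup s = ⊤ → ⊤ ∈ s

/-- The diagonal `X ⟶ X × X`. -/
def diagonal (X : Locale.{u}) : X ⟶ X ⊗ X := lift (𝟙 X) (𝟙 X)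

/-- The diagonal is a closed (that is, proper) sublocale. -/
def IsHausdorffLocale (X : Locale.{u}) : Prop := IsProperMap (diagonal X)

/-- Compact Hausdorff locales. -/
structure IsCompactHausdorff (X : Locale.{u}) : Prop where
  compact : IsCompactLocale X
  hausdorff : IsHausdorffLocale X

/-- The open of `X × X` complementary to the (closure of the) diagonal: the largest open whose
inverse image along the diagonal is `⊥`. -/
def diagonalCompl (X : Locale.{u}) : (X ⊗ X : Locale.{u}) := directImage (diagonal X) ⊥

/-! ## The Sierpiński locale -/

/-- The Sierpiński locale `𝕊`, the locale of opens of the Sierpiński space `Prop`. -/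
def sierpinski : Locale.{u} := Locale.of (TopologicalSpace.Opens (ULift.{u} Prop))

/-- The open `{True}` of the Sierpiński space. -/
def trueOpens : TopologicalSpace.Opens (ULift.{u} Prop) :=
  ⟨ULift.down ⁻¹' {True}, isOpen_singleton_true.preimage continuous_uliftDown⟩

theorem mem_trueOpens (x : ULift.{u} Prop) : x ∈ trueOpens ↔ x.down = True := Iff.rfl

/-- The generic open `{True}` of the Sierpiński locale. -/
def genericOpen : sierpinski.{u} := trueOpens

theorem eq_top_of_false_mem (U : TopologicalSpace.Opens (ULift.{u} Prop))
    (h : ULift.up False ∈ U) : U = ⊤ := by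
  obtain ⟨V, hV, hVU⟩ := U.isOpen
  have hF : False ∈ V := by
    have h' : ULift.up False ∈ (U : Set (ULift.{u} Prop)) := h
    rw [← hVU] at h'
    exact h'
  have hV' : V = Set.univ := by
    have h' := hV.mem_nhds hF
    rwa [nhds_false, Filter.mem_top] at h'
  refine TopologicalSpace.Opens.ext ?_
  rw [← hVU, hV']
  rfl

/-- The frame homomorphism from the opens of the Sierpiński locale sending `{True}` to `b`. -/
def sierpinskiDesc {B : Type u} [Order.Frame B] (b : B) :
    FrameHom (TopologicalSpace.Opens (ULift.{u} Prop)) B where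
  toFun U := (⨆ _ : ULift.up False ∈ U, ⊤) ⊔ ⨆ _ : ULift.up True ∈ U, b
  map_inf' U V := by
    by_cases hU : ULift.up False ∈ U
    · rw [eq_top_of_false_mem U hU]
      simp
    by_cases hV : ULift.up False ∈ V
    · rw [eq_top_of_false_mem V hV]
      simp
    by_cases hU' : ULift.up True ∈ U <;> by_cases hV' : ULift.up True ∈ V <;>
      simp [hU, hV, hU', hV']
  map_top' := by simp
  map_sSup' s := by
    refine eq_of_forall_ge_iff fun c => ?_
    simp only [sup_le_iff, iSup_le_iff, sSup_le_iff, Set.forall_mem_image,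
      TopologicalSpace.Opens.mem_sSup]
    constructor
    · rintro ⟨h₁, h₂⟩ U hU
      exact ⟨fun h => h₁ ⟨U, hU, h⟩, fun h => h₂ ⟨U, hU, h⟩⟩
    · intro h
      exact ⟨fun ⟨U, hU, hx⟩ => (h hU).1 hx, fun ⟨U, hU, hx⟩ => (h hU).2 hx⟩

/-- Locale morphisms `B ⟶ 𝕊` correspond to opens of `B` (equivalently, by complementation, to
closed sublocales of `B`). -/
def opensEquiv (B : Locale.{u}) : (B ⟶ sierpinski.{u}) ≃ B where
  toFun f := inverseImage f genericOpen
  invFun b := ofFrameHom (sierpinskiDesc b)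
  left_inv f := by
    refine locale_hom_ext fun (U : TopologicalSpace.Opens (ULift.{u} Prop)) => ?_
    change sierpinskiDesc (inverseImage f genericOpen) U = inverseImage f U
    by_cases hF : ULift.up False ∈ U
    · rw [eq_top_of_false_mem U hF]
      exact (map_top _).trans (map_top (inverseImage f)).symm
    · by_cases hT : ULift.up True ∈ U
      · have hU : U = trueOpens := by
          refine TopologicalSpace.Opens.ext (Set.ext fun x => ?_)
          refine Iff.trans ?_ (mem_trueOpens x).symm
          obtain ⟨p⟩ := x
          by_cases hp : p <;> simp [hp, hF, hT]
        have hb : sierpinskiDesc (inverseImage f genericOpen) U = inverseImage f genericOpen := by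
          simp [sierpinskiDesc, hF, hT]
        rw [hb, hU]
        rfl
      · have hU : U = ⊥ := by
          refine TopologicalSpace.Opens.ext (Set.ext fun x => ?_)
          obtain ⟨p⟩ := x
          by_cases hp : p <;> simp [hp, hF, hT]
        rw [hU]
        exact (map_bot _).trans (map_bot (inverseImage f)).symm
  right_inv b := by
    have hF : ULift.up False ∉ trueOpens.{u} := by simp [mem_trueOpens]
    have hT : ULift.up True ∈ trueOpens.{u} := by simp [mem_trueOpens]
    change (⨆ _ : ULift.up False ∈ trueOpens.{u}, ⊤) ⊔ (⨆ _ : ULift.up True ∈ trueOpens.{u}, b) = b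
    simp [hF, hT]

/-- The internal join operation `∨ : 𝕊 × 𝕊 ⟶ 𝕊`. -/
def sierpinskiJoin : (sierpinski ⊗ sierpinski : Locale.{u}) ⟶ sierpinski :=
  (opensEquiv _).symm
    (inverseImage (fst sierpinski sierpinski) genericOpen ⊔
      inverseImage (snd sierpinski sierpinski) genericOpen)

/-- The point `⊥ : 1 ⟶ 𝕊`. -/
def sierpinskiBot : 𝟙_ Locale.{u} ⟶ sierpinski :=
  (opensEquiv _).symm ⊥

/-! ## Exponentials of the Sierpiński locale -/

/-- An exponential `𝕊^X` in the category of locales. -/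
structure SierpinskiPower (X : Locale.{u}) where
  /-- the locale `𝕊^X` -/
  obj : Locale.{u}
  /-- the evaluation map `𝕊^X × X ⟶ 𝕊` -/
  ev : obj ⊗ X ⟶ sierpinski
  existsUnique_transpose : ∀ (A : Locale.{u}) (f : A ⊗ X ⟶ sierpinski),
    ∃! g : A ⟶ obj, g ▷ X ≫ ev = f

namespace SierpinskiPower

variable {X Y A : Locale.{u}}

/-- The exponential transpose `A ⟶ 𝕊^X` of a morphism `A × X ⟶ 𝕊`. -/
noncomputable def transpose (E : SierpinskiPower X) (f : A ⊗ X ⟶ sierpinski) : A ⟶ E.obj :=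
  (E.existsUnique_transpose A f).choose

/-- The morphism `A × X ⟶ 𝕊` whose exponential transpose is `g`. -/
def untranspose (E : SierpinskiPower X) (g : A ⟶ E.obj) : A ⊗ X ⟶ sierpinski :=
  g ▷ X ≫ E.ev

/-- The open of `A × X` classified by `g : A ⟶ 𝕊^X`. -/
def classified (E : SierpinskiPower X) (g : A ⟶ E.obj) : (A ⊗ X : Locale.{u}) :=
  opensEquiv _ (E.untranspose g)

/-- The morphism `𝕊^φ : 𝕊^X ⟶ 𝕊^Y` induced by `φ : Y ⟶ X`. -/
noncomputable def map (E : SierpinskiPower X) (F : SierpinskiPower Y) (φ : Y ⟶ X) :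
    E.obj ⟶ F.obj :=
  F.transpose (E.obj ◁ φ ≫ E.ev)

/-- The join `g ∨ h : A ⟶ 𝕊^X`, computed with the internal join operation of `𝕊`. -/
noncomputable def join (E : SierpinskiPower X) (g h : A ⟶ E.obj) : A ⟶ E.obj :=
  E.transpose (lift (E.untranspose g) (E.untranspose h) ≫ sierpinskiJoin)

/-- The point `⊥ : 1 ⟶ 𝕊^X`, the transpose of `1 × X ⟶ 1 ⟶ 𝕊`. -/
noncomputable def bot (E : SierpinskiPower X) : 𝟙_ Locale.{u} ⟶ E.obj :=
  E.transpose (toUnit (𝟙_ Locale.{u} ⊗ X) ≫ sierpinskiBot)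

end SierpinskiPower

/-- The morphism `X × X ⟶ 𝕊` classifying the closed diagonal of `X`. -/
def diagonalMap (X : Locale.{u}) : X ⊗ X ⟶ sierpinski :=
  (opensEquiv _).symm (diagonalCompl X)

/-- The morphism `i : X ⟶ 𝕊^X`, `x ↦ {x}`. -/
noncomputable def singletonMap {X : Locale.{u}} (E : SierpinskiPower X) : X ⟶ E.obj :=
  E.transpose (diagonalMap X)

/-- The morphism `d : 1 ⟶ 𝕊^(X × X)` picking out the closed diagonal. -/
noncomputable def diagonalPoint {X : Locale.{u}} (F : SierpinskiPower (X ⊗ X)) :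
    𝟙_ Locale.{u} ⟶ F.obj :=
  F.transpose ((λ_ (X ⊗ X)).hom ≫ diagonalMap X)

/-! ## Adjoints and inserters in the order-enriched category of locales -/

/-- `r` is right adjoint to `l`. -/
structure IsRightAdjointOf {P Q : Locale.{u}} (r : Q ⟶ P) (l : P ⟶ Q) : Prop where
  unit : 𝟙 P ≤ l ≫ r
  counit : r ≫ l ≤ 𝟙 Q

/-- `i : E ⟶ P` is the inserter of `g, f : P ⟶ Q`: the universal morphism to `P` whose composite
with `g` is less than or equal to its composite with `f`. -/
structure IsInserter {E P Q : Locale.{u}} (i : E ⟶ P) (g f : P ⟶ Q) : Prop where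
  condition : i ≫ g ≤ i ≫ f
  existsUnique_lift : ∀ (A : Locale.{u}) (h : A ⟶ P), h ≫ g ≤ h ≫ f → ∃! k : A ⟶ E, k ≫ i = h
  le_of_comp_le : ∀ (A : Locale.{u}) (k k' : A ⟶ E), k ≫ i ≤ k' ≫ i → k ≤ k'

end CompactHausdorffLocale

/-!
Morphisms `A ⟶ 𝕊^X` are the closed relations from `A` to `X`, described by their open complements,
and `i : X ⟶ 𝕊^X` corresponds to the diagonal relation, so that `k ≫ i` corresponds to the graph of
`k`. The two components of the inserter condition say that a relation is single-valued and total.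
When `X` is compact Hausdorff, such a functional relation is the graph of a unique morphism, whose
inverse image map sends `x` to the open of points of `A` all of whose related points lie in `x`.
This map preserves directed joins because `X` is compact; for binary joins one moves from one
related point to another by single-valuedness, and the projection `A × X × X ⟶ A` takes joins of
opens in independent variables to joins, again by compactness.
-/

namespace CompactHausdorffLocale

theorem sSup_mem_of_supClosed_of_dirSupClosed {α : Type*} [CompleteLattice α] {s t : Set α}
    (hbot : ⊥ ∈ s) (hsup : SupClosed s) (hdir : DirSupClosed s) (hts : t ⊆ s) : sSup t ∈ s := by
  have hclosure : supClosure (insert ⊥ t) ⊆ s :=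
    supClosure_min (Set.insert_subset hbot hts) hsup
  refine hdir hclosure ⟨⊥, subset_supClosure (Set.mem_insert _ _)⟩
    supClosed_supClosure.directedOn (isLUB_supClosure.2 ?_)
  simpa only [sSup_insert, bot_sup_eq] using isLUB_sSup (insert ⊥ t)

theorem isLUB_image_sup_right {α : Type*} [SemilatticeSup α] {D : Set α} {b : α}
    (hD : D.Nonempty) (hb : IsLUB D b) (c : α) : IsLUB ((· ⊔ c) '' D) (b ⊔ c) := by
  refine ⟨Set.forall_mem_image.2 fun d hd => sup_le_sup_right (hb.1 hd) c, fun u hu => ?_⟩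
  obtain ⟨d, hd⟩ := hD
  exact sup_le (hb.2 fun d hd => le_sup_left.trans (hu ⟨d, hd, rfl⟩))
    (le_sup_right.trans (hu ⟨d, hd, rfl⟩))

/-! ## Rectangles in products of locales -/

section Rectangles

variable {A B C D : Locale.{u}}

theorem gc_inverseImage_directImage (f : A ⟶ B) :
    GaloisConnection (inverseImage f) (directImage f) :=
  fun v a => (le_directImage_iff f a v).symm

theorem inverseImage_mono (f : A ⟶ B) : Monotone (inverseImage f) :=
  OrderHomClass.mono _

theorem inverseImage_id (a : A) : inverseImage (𝟙 A) a = a :=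
  rfl

/-- The open rectangle `a × b`. -/
def rect (a : A) (b : B) : (A ⊗ B : Locale.{u}) :=
  inverseImage (fst A B) a ⊓ inverseImage (snd A B) b

theorem rect_mono {a a' : A} {b b' : B} (ha : a ≤ a') (hb : b ≤ b') : rect a b ≤ rect a' b' :=
  inf_le_inf (inverseImage_mono _ ha) (inverseImage_mono _ hb)

theorem rect_top (a : A) : rect a (⊤ : B) = inverseImage (fst A B) a := by
  rw [rect, map_top, inf_top_eq]

theorem top_rect (b : B) : rect (⊤ : A) b = inverseImage (snd A B) b := by
  rw [rect, map_top, top_inf_eq]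

theorem rect_top_le_iff {a : A} {W : (A ⊗ B : Locale.{u})} :
    rect a ⊤ ≤ W ↔ a ≤ directImage (fst A B) W := by
  rw [le_directImage_iff, rect_top]

theorem inverseImage_rect (f : C ⟶ A ⊗ B) (a : A) (b : B) :
    inverseImage f (rect a b) = inverseImage (f ≫ fst A B) a ⊓ inverseImage (f ≫ snd A B) b := by
  rw [rect, map_inf, inverseImage_comp, inverseImage_comp]

theorem inverseImage_whiskerRight_rect (f : C ⟶ A) (a : A) (d : D) :
    inverseImage (f ▷ D) (rect a d) = rect (inverseImage f a) d := by
  rw [inverseImage_rect, whiskerRight_fst, whiskerRight_snd, inverseImage_comp, rect]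

theorem inverseImage_whiskerLeft_rect (f : C ⟶ A) (d : D) (a : A) :
    inverseImage (D ◁ f) (rect d a) = rect d (inverseImage f a) := by
  rw [inverseImage_rect, whiskerLeft_fst, whiskerLeft_snd, inverseImage_comp, rect]

theorem rect_le_iff_mem (a : A) (b : B) (W : prodFrame A B) :
    rect a b ≤ (show (A ⊗ B : Locale.{u}) from W) ↔ (a, b) ∈ W.1 := by
  rw [← restrict_le_iff, ← prodInl_inf_prodInr]
  exact Iff.rfl

theorem exists_forall_rect_le_iff (L : A → B → Prop)
    (mono : ∀ {a a' b b'}, a' ≤ a → b' ≤ b → L a b → L a' b')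
    (sSup_left : ∀ (s : Set A) b, (∀ a ∈ s, L a b) → L (sSup s) b)
    (sSup_right : ∀ a (t : Set B), (∀ b ∈ t, L a b) → L a (sSup t)) :
    ∃ W : (A ⊗ B : Locale.{u}), ∀ a b, rect a b ≤ W ↔ L a b :=
  ⟨(⟨⟨{p | L p.1 p.2}, fun _ _ h => mono h.1 h.2⟩, sSup_left, sSup_right⟩ : prodFrame A B),
    fun a b => rect_le_iff_mem a b _⟩

theorem le_iff_forall_rect_le {W V : (A ⊗ B : Locale.{u})} :
    W ≤ V ↔ ∀ a b, rect a b ≤ W → rect a b ≤ V :=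
  ⟨fun h _ _ hab => hab.trans h, fun h p hp =>
    (rect_le_iff_mem p.1 p.2 V).1 (h _ _ ((rect_le_iff_mem p.1 p.2 W).2 hp))⟩

theorem rect_sSup_left_le {s : Set A} {b : B} {W : (A ⊗ B : Locale.{u})}
    (h : ∀ a ∈ s, rect a b ≤ W) : rect (sSup s) b ≤ W :=
  (rect_le_iff_mem _ _ W).2 (W.2.1 s b fun a ha => (rect_le_iff_mem a b W).1 (h a ha))

theorem rect_sSup_right_le {a : A} {t : Set B} {W : (A ⊗ B : Locale.{u})}
    (h : ∀ b ∈ t, rect a b ≤ W) : rect a (sSup t) ≤ W :=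
  (rect_le_iff_mem _ _ W).2 (W.2.2 a t fun b hb => (rect_le_iff_mem a b W).1 (h b hb))

theorem rect_bot_le (a : A) (W : (A ⊗ B : Locale.{u})) : rect a ⊥ ≤ W := by
  rw [rect, map_bot, inf_bot_eq]
  exact bot_le

theorem rect_inf_sup_le {a a' : A} {b b' : B} {W : (A ⊗ B : Locale.{u})}
    (h : rect a b ≤ W) (h' : rect a' b' ≤ W) : rect (a ⊓ a') (b ⊔ b') ≤ W := by
  rw [← sSup_pair]
  refine rect_sSup_right_le ?_
  rintro _ (rfl | rfl)
  · exact (rect_mono inf_le_left le_rfl).trans h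
  · exact (rect_mono inf_le_right le_rfl).trans h'

/-- The join of the rectangles `a × b` with `L a b`: the open of `A × B` presented by `L`. -/
def unionRect (L : A → B → Prop) : (A ⊗ B : Locale.{u}) :=
  ⨆ (a) (b) (_ : L a b), rect a b

theorem rect_le_unionRect {L : A → B → Prop} {a : A} {b : B} (h : L a b) :
    rect a b ≤ unionRect L :=
  le_iSup₂_of_le a b (le_iSup_of_le h le_rfl)

theorem unionRect_le_iff {L : A → B → Prop} {W : (A ⊗ B : Locale.{u})} :
    unionRect L ≤ W ↔ ∀ a b, L a b → rect a b ≤ W := by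
  simp only [unionRect, iSup_le_iff]

theorem inverseImage_le_iff_forall_rect {f : C ⟶ A ⊗ B} {W : (A ⊗ B : Locale.{u})} {c : C} :
    inverseImage f W ≤ c ↔ ∀ a b, rect a b ≤ W → inverseImage f (rect a b) ≤ c := by
  simp only [← le_directImage_iff]
  exact le_iff_forall_rect_le

theorem inverseImage_unionRect_le_iff {f : C ⟶ A ⊗ B} {L : A → B → Prop} {c : C} :
    inverseImage f (unionRect L) ≤ c ↔ ∀ a b, L a b → inverseImage f (rect a b) ≤ c := by
  simp only [← le_directImage_iff, unionRect_le_iff]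

theorem rect_le_sup_iff {a a' : A} {b b' : B} :
    rect a b ≤ inverseImage (fst A B) a' ⊔ inverseImage (snd A B) b' ↔ a ≤ a' ∨ b ≤ b' := by
  constructor
  · obtain ⟨V, hV⟩ := exists_forall_rect_le_iff (A := A) (B := B) (fun x y => x ≤ a' ∨ y ≤ b')
      (fun ha hb h => h.imp ha.trans hb.trans)
      (fun s y h => or_iff_not_imp_right.2 fun hy =>
        sSup_le fun x hx => (h x hx).resolve_right hy)
      (fun x t h => or_iff_not_imp_left.2 fun hx =>
        sSup_le fun y hy => (h y hy).resolve_left hx)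
    have hsup : inverseImage (fst A B) a' ⊔ inverseImage (snd A B) b' ≤ V := by
      rw [← rect_top, ← top_rect]
      exact sup_le ((hV _ _).2 (Or.inl le_rfl)) ((hV _ _).2 (Or.inr le_rfl))
    exact fun h => (hV a b).1 (h.trans hsup)
  · rintro (h | h)
    · exact inf_le_left.trans ((inverseImage_mono _ h).trans le_sup_left)
    · exact inf_le_right.trans ((inverseImage_mono _ h).trans le_sup_right)

theorem inverseImage_le_sup_of_fst_snd {f g : C ⟶ A ⊗ B} {n : C}
    (hfst : ∀ a, inverseImage (f ≫ fst A B) a ≤ inverseImage (g ≫ fst A B) a ⊔ n)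
    (hsnd : ∀ b, inverseImage (f ≫ snd A B) b ≤ inverseImage (g ≫ snd A B) b ⊔ n)
    (W : (A ⊗ B : Locale.{u})) : inverseImage f W ≤ inverseImage g W ⊔ n := by
  refine inverseImage_le_iff_forall_rect.2 fun a b hab => ?_
  refine le_trans ?_ (sup_le_sup_right (inverseImage_mono g hab) n)
  rw [inverseImage_rect, inverseImage_rect, sup_inf_right]
  exact inf_le_inf (hfst a) (hsnd b)

theorem hom_le_iff {f g : C ⟶ A ⊗ B} :
    f ≤ g ↔ f ≫ fst A B ≤ g ≫ fst A B ∧ f ≫ snd A B ≤ g ≫ snd A B := by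
  refine ⟨fun h => ⟨fun v => h _, fun v => h _⟩, fun ⟨hfst, hsnd⟩ W => ?_⟩
  simpa only [sup_bot_eq] using inverseImage_le_sup_of_fst_snd (n := ⊥)
    (fun a => (hfst a).trans le_sup_left) (fun b => (hsnd b).trans le_sup_left) W

end Rectangles

theorem comp_le_comp {A B C : Locale.{u}} {f f' : A ⟶ B} {g g' : B ⟶ C} (hf : f ≤ f')
    (hg : g ≤ g') : f ≫ g ≤ f' ≫ g' := fun v =>
  (hf (inverseImage g v)).trans (inverseImage_mono f' (hg v))

/-! ## Scott open sets of opens -/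

/-- The Scott open subsets of `α`, that is, its upper sets inaccessible by directed joins. The
points of the space are those of `Topology.WithScott α`, a copy of `α` with the Scott topology. -/
abbrev ScottOpens (α : Type*) [Preorder α] : Type _ :=
  TopologicalSpace.Opens (Topology.WithScott α)

namespace ScottOpens

open Topology.WithScott (toScott)

variable {α : Type*}

/-- The Scott open subset with the given underlying set. -/
def ofDirSupInacc [Preorder α] (s : Set α) (hup : IsUpperSet s) (hdir : DirSupInacc s) :
    ScottOpens α :=
  ⟨s, (Topology.IsScott.isOpen_iff_isUpperSet_and_dirSupInaccOn (D := Set.univ)).2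
    ⟨hup, dirSupInaccOn_univ.2 hdir⟩⟩

theorem mem_of_le [Preorder α] (S : ScottOpens α) {a b : α} (hab : a ≤ b) (ha : toScott a ∈ S) :
    toScott b ∈ S :=
  Topology.IsScott.isUpperSet_of_isOpen (D := Set.univ) S.isOpen hab ha

theorem exists_mem_of_isLUB [Preorder α] (S : ScottOpens α) {D : Set α} {b : α} (hD : D.Nonempty)
    (hdir : DirectedOn (· ≤ ·) D) (hb : IsLUB D b) (hbS : toScott b ∈ S) :
    ∃ d ∈ D, toScott d ∈ S :=
  (Topology.IsScott.isOpen_iff_isUpperSet_and_dirSupInaccOn (D := Set.univ)).1 S.isOpen |>.2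
    trivial hD hdir hb hbS

theorem exists_sup_mem_of_isLUB [SemilatticeSup α] (S : ScottOpens α) {D : Set α} {b c : α}
    (hD : D.Nonempty) (hdir : DirectedOn (· ≤ ·) D) (hb : IsLUB D b)
    (hbS : toScott (b ⊔ c) ∈ S) : ∃ d ∈ D, toScott (d ⊔ c) ∈ S := by
  have hdir' : DirectedOn (· ≤ ·) ((· ⊔ c) '' D) :=
    directedOn_image.2 (hdir.mono fun _ _ h => sup_le_sup_right h c)
  obtain ⟨_, ⟨d, hd, rfl⟩, hdS⟩ :=
    S.exists_mem_of_isLUB (hD.image _) hdir' (isLUB_image_sup_right hD hb c) hbS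
  exact ⟨d, hd, hdS⟩

/-- The lower bounds of a Scott open subset. If `b` is a lower bound of a Scott open neighbourhood
of `a`, then `b` is way below `a`. -/
def lowerBounds [Preorder α] (S : ScottOpens α) : Set α :=
  {b | ∀ c, toScott c ∈ S → b ≤ c}

theorem bot_mem_lowerBounds [Preorder α] [OrderBot α] (S : ScottOpens α) : ⊥ ∈ S.lowerBounds :=
  fun _ _ => bot_le

theorem sup_mem_lowerBounds_inf [SemilatticeSup α] {S T : ScottOpens α} {b c : α}
    (hb : b ∈ S.lowerBounds) (hc : c ∈ T.lowerBounds) : b ⊔ c ∈ (S ⊓ T).lowerBounds :=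
  fun d hd => sup_le (hb d hd.1) (hc d hd.2)

end ScottOpens

/-! ## Fibrewise membership in a Scott open set -/

section FiberMem

open Topology.WithScott (toScott)

variable {A B C : Locale.{u}}

/-- The open of those points `a` of `A` whose fibre `W_a = {b | (a, b) ∈ W}` belongs to the Scott
open set `S`. As `S` varies this is the inverse image map of the morphism `A ⟶ 𝕊^B` classifying
`W`, and for `S = {⊤}` it is the image of the closed complement of `W` along `A × B ⟶ A`. -/
def fiberMem (W : (A ⊗ B : Locale.{u})) (S : ScottOpens B) : A :=
  sSup {a | ∃ b, toScott b ∈ S ∧ rect a b ≤ W}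

theorem le_fiberMem {W : (A ⊗ B : Locale.{u})} {S : ScottOpens B} {a : A} {b : B}
    (hb : toScott b ∈ S) (h : rect a b ≤ W) : a ≤ fiberMem W S :=
  le_sSup ⟨b, hb, h⟩

theorem fiberMem_le_iff {W : (A ⊗ B : Locale.{u})} {S : ScottOpens B} {c : A} :
    fiberMem W S ≤ c ↔ ∀ a b, toScott b ∈ S → rect a b ≤ W → a ≤ c :=
  sSup_le_iff.trans ⟨fun h a b hb hab => h a ⟨b, hb, hab⟩, fun h a ⟨b, hb, hab⟩ => h a b hb hab⟩

theorem fiberMem_mono {W V : (A ⊗ B : Locale.{u})} (h : W ≤ V) (S : ScottOpens B) :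
    fiberMem W S ≤ fiberMem V S :=
  fiberMem_le_iff.2 fun _ _ hb hab => le_fiberMem hb (hab.trans h)

theorem supClosed_setOf_le_sSup_sup_mem {L : A → B → Prop}
    (sup : ∀ {a a' b b'}, L a b → L a' b' → L (a ⊓ a') (b ⊔ b')) (S : ScottOpens B) (a : A) :
    SupClosed {b | ∀ c, toScott (b ⊔ c) ∈ S →
      a ≤ sSup {a' | ∃ b', L a' b' ∧ toScott (b' ⊔ c) ∈ S}} := by
  intro b₁ h₁ b₂ h₂ c hc
  rw [sup_assoc] at hc
  rw [← inf_eq_left.2 (h₁ _ hc), inf_sSup_eq]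
  refine iSup₂_le ?_
  rintro a₁ ⟨b₁', hL₁, hb₁'⟩
  rw [sup_left_comm] at hb₁'
  refine (inf_le_inf_right a₁ (h₂ _ hb₁')).trans ?_
  rw [sSup_inf_eq]
  refine iSup₂_le ?_
  rintro a₂ ⟨b₂', hL₂, hb₂'⟩
  have hmem : a₂ ⊓ a₁ ∈ {a' | ∃ b', L a' b' ∧ toScott (b' ⊔ c) ∈ S} :=
    ⟨b₂' ⊔ b₁', sup hL₂ hL₁, by rwa [sup_assoc]⟩
  exact le_sSup hmem

theorem dirSupClosed_setOf_le_of_sup_mem (S : ScottOpens B) (a : A) (u : B → A) :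
    DirSupClosed {b | ∀ c, toScott (b ⊔ c) ∈ S → a ≤ u c} := by
  intro D hD hne hdir b hb c hc
  obtain ⟨d, hd, hdS⟩ := S.exists_sup_mem_of_isLUB hne hdir hb hc
  exact hD hd c hdS

theorem fiberMem_le_sSup_of_le_unionRect {L : A → B → Prop} (bot : ∀ a, L a ⊥)
    (sup : ∀ {a a' b b'}, L a b → L a' b' → L (a ⊓ a') (b ⊔ b'))
    {W : (A ⊗ B : Locale.{u})} (hW : W ≤ unionRect L) (S : ScottOpens B) :
    fiberMem W S ≤ sSup {a | ∃ b, L a b ∧ toScott b ∈ S} := by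
  let u (c : B) : A := sSup {a' | ∃ b', L a' b' ∧ toScott (b' ⊔ c) ∈ S}
  have le_u {a : A} {b c : B} (hab : L a b) (hc : toScott (b ⊔ c) ∈ S) : a ≤ u c :=
    le_sSup ⟨b, hab, hc⟩
  -- Quantifying over `c`, rather than taking `c = ⊥`, makes the condition stable under binary joins
  -- in `b`.
  obtain ⟨V, hV⟩ := exists_forall_rect_le_iff (A := A) (B := B)
    (fun a b => ∀ c, toScott (b ⊔ c) ∈ S → a ≤ u c)
    (fun ha hb h c hc => ha.trans (h c (S.mem_of_le (sup_le_sup_right hb c) hc)))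
    (fun s b h c hc => sSup_le fun a ha => h a ha c hc)
    (fun a t h => sSup_mem_of_supClosed_of_dirSupClosed
      (s := {b | ∀ c, toScott (b ⊔ c) ∈ S → a ≤ u c}) (fun _ => le_u (bot a))
      (supClosed_setOf_le_sSup_sup_mem sup S a) (dirSupClosed_setOf_le_of_sup_mem S a u) h)
  have hLV : unionRect L ≤ V :=
    unionRect_le_iff.2 fun a b hab => (hV a b).2 fun c hc => le_u hab hc
  refine fiberMem_le_iff.2 fun a b hb hab => ?_
  simpa only [u, sup_bot_eq] using
    (hV a b).1 (hab.trans (hW.trans hLV)) ⊥ (by rwa [sup_bot_eq])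

theorem fiberMem_inverseImage_whiskerRight (f : C ⟶ A) (W : (A ⊗ B : Locale.{u}))
    (S : ScottOpens B) :
    fiberMem (inverseImage (f ▷ B) W) S = inverseImage f (fiberMem W S) := by
  refine le_antisymm ?_ ?_
  · refine (fiberMem_le_sSup_of_le_unionRect
      (L := fun c b => ∃ a, c ≤ inverseImage f a ∧ rect a b ≤ W) ?_ ?_ ?_ S).trans (sSup_le ?_)
    · exact fun c => ⟨⊤, le_top.trans (map_top _).ge, rect_bot_le _ _⟩
    · rintro c c' b b' ⟨a, hca, hab⟩ ⟨a', hca', hab'⟩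
      exact ⟨a ⊓ a', (inf_le_inf hca hca').trans (map_inf _ _ _).ge, rect_inf_sup_le hab hab'⟩
    · refine inverseImage_le_iff_forall_rect.2 fun a b hab => ?_
      rw [inverseImage_whiskerRight_rect]
      exact rect_le_unionRect ⟨a, le_rfl, hab⟩
    · rintro c ⟨b, ⟨a, hca, hab⟩, hb⟩
      exact hca.trans (inverseImage_mono f (le_fiberMem hb hab))
  · rw [← le_directImage_iff]
    refine fiberMem_le_iff.2 fun a b hb hab => (le_directImage_iff _ _ _).2 (le_fiberMem hb ?_)
    rw [← inverseImage_whiskerRight_rect]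
    exact inverseImage_mono _ hab

theorem fiberMem_sSup {s : Set (A ⊗ B : Locale.{u})} (hs : s.Nonempty)
    (hd : DirectedOn (· ≤ ·) s) (S : ScottOpens B) :
    fiberMem (sSup s) S = sSup ((fiberMem · S) '' s) := by
  refine le_antisymm ?_ (sSup_le (Set.forall_mem_image.2 fun W hW =>
    fiberMem_mono (le_sSup hW) S))
  refine (fiberMem_le_sSup_of_le_unionRect (L := fun a b => ∃ W ∈ s, rect a b ≤ W) ?_ ?_ ?_
    S).trans (sSup_le ?_)
  · obtain ⟨W, hW⟩ := hs
    exact fun a => ⟨W, hW, rect_bot_le _ _⟩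
  · rintro a a' b b' ⟨W, hW, hab⟩ ⟨W', hW', hab'⟩
    obtain ⟨V, hV, hWV, hWV'⟩ := hd W hW W' hW'
    exact ⟨V, hV, rect_inf_sup_le (hab.trans hWV) (hab'.trans hWV')⟩
  · exact sSup_le fun W hW => le_iff_forall_rect_le.2 fun a b hab =>
      rect_le_unionRect ⟨W, hW, hab⟩
  · rintro a ⟨b, ⟨W, hW, hab⟩, hb⟩
    exact (le_fiberMem hb hab).trans (le_sSup ⟨W, hW, rfl⟩)

end FiberMem

/-! ## Compactness -/

section Compact

open Topology.WithScott (toScott)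

variable {A B C : Locale.{u}}

/-- For compact `B`, the Scott open set `{⊤}`. -/
def IsCompactLocale.topOpen (hB : IsCompactLocale B) : ScottOpens B :=
  ScottOpens.ofDirSupInacc {⊤} (fun _ _ hab ha => top_le_iff.1 (ha.ge.trans hab))
    fun s hs hdir _ hb hbtop => ⟨⊤, hB s hs hdir (hb.sSup_eq.trans hbtop), rfl⟩

theorem IsCompactLocale.mem_topOpen (hB : IsCompactLocale B) {b : B} :
    toScott b ∈ hB.topOpen ↔ b = ⊤ :=
  Iff.rfl

theorem IsCompactLocale.directImage_fst_eq_fiberMem (hB : IsCompactLocale B)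
    (W : (A ⊗ B : Locale.{u})) : directImage (fst A B) W = fiberMem W hB.topOpen := by
  refine le_antisymm (le_fiberMem rfl (rect_top_le_iff.2 le_rfl)) (fiberMem_le_iff.2 ?_)
  rintro a _ rfl hab
  exact rect_top_le_iff.1 hab

theorem IsCompactLocale.directImage_fst_sSup (hB : IsCompactLocale B)
    {s : Set (A ⊗ B : Locale.{u})} (hs : s.Nonempty) (hd : DirectedOn (· ≤ ·) s) :
    directImage (fst A B) (sSup s) = sSup (directImage (fst A B) '' s) := by
  simp only [funext hB.directImage_fst_eq_fiberMem]
  exact fiberMem_sSup hs hd _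

theorem IsCompactLocale.directImage_fst_inverseImage_whiskerRight (hB : IsCompactLocale B)
    (f : C ⟶ A) (W : (A ⊗ B : Locale.{u})) :
    directImage (fst C B) (inverseImage (f ▷ B) W) = inverseImage f (directImage (fst A B) W) := by
  rw [hB.directImage_fst_eq_fiberMem, hB.directImage_fst_eq_fiberMem,
    fiberMem_inverseImage_whiskerRight]

theorem IsCompactLocale.prod (hA : IsCompactLocale A) (hB : IsCompactLocale B) :
    IsCompactLocale (A ⊗ B) := by
  intro s hs hd htop
  have hdir : DirectedOn (· ≤ ·) (directImage (fst A B) '' s) :=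
    directedOn_image.2 (hd.mono fun _ _ h => (gc_inverseImage_directImage _).monotone_u h)
  have hsup : sSup (directImage (fst A B) '' s) = ⊤ := by
    rw [← hB.directImage_fst_sSup hs hd, htop, (gc_inverseImage_directImage _).u_top]
  obtain ⟨W, hW, hWtop⟩ := hA _ (hs.image _) hdir hsup
  have hW' : W = ⊤ := by
    have := (le_directImage_iff _ _ _).1 hWtop.ge
    rwa [map_top, top_le_iff] at this
  exact hW' ▸ hW

theorem isCompactLocale_point : IsCompactLocale (𝟙_ Locale.{u}) := by
  intro (s : Set (Set PUnit)) _ _ htop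
  obtain ⟨U, hU, hmem⟩ : PUnit.unit ∈ ⋃₀ s := htop.ge (Set.mem_univ _)
  have hUtop : U = (⊤ : Set PUnit) := Set.eq_univ_of_forall fun _ => hmem
  exact hUtop ▸ hU

theorem le_directImage_sup_directImage (hA : IsCompactLocale A) (hB : IsCompactLocale B)
    {U : (C ⊗ A : Locale.{u})} {V : (C ⊗ B : Locale.{u})} {c : C}
    (h : inverseImage (fst C (A ⊗ B)) c ≤
      inverseImage (C ◁ fst A B) U ⊔ inverseImage (C ◁ snd A B) V) :
    c ≤ directImage (fst C A) U ⊔ directImage (fst C B) V := by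
  rw [← le_directImage_iff, (hA.prod hB).directImage_fst_eq_fiberMem] at h
  refine h.trans ((fiberMem_le_sSup_of_le_unionRect (L := fun c w => ∃ a b, rect c a ≤ U ∧
    rect c b ≤ V ∧ w ≤ inverseImage (fst A B) a ⊔ inverseImage (snd A B) b) ?_ ?_ ?_ _).trans
      (sSup_le ?_))
  · exact fun c => ⟨⊥, ⊥, rect_bot_le _ _, rect_bot_le _ _, bot_le⟩
  · rintro c c' w w' ⟨a, b, ha, hb, hw⟩ ⟨a', b', ha', hb', hw'⟩
    refine ⟨a ⊔ a', b ⊔ b', rect_inf_sup_le ha ha', rect_inf_sup_le hb hb', ?_⟩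
    rw [map_sup, map_sup, sup_sup_sup_comm]
    exact sup_le_sup hw hw'
  · refine sup_le (inverseImage_le_iff_forall_rect.2 fun c a ha => ?_)
      (inverseImage_le_iff_forall_rect.2 fun c b hb => ?_)
    · rw [inverseImage_whiskerLeft_rect]
      exact rect_le_unionRect ⟨a, ⊥, ha, rect_bot_le _ _, le_sup_left⟩
    · rw [inverseImage_whiskerLeft_rect]
      exact rect_le_unionRect ⟨⊥, b, rect_bot_le _ _, hb, le_sup_right⟩
  · rintro c ⟨w, ⟨a, b, ha, hb, hw⟩, hwtop⟩
    have htop : rect ⊤ ⊤ ≤ inverseImage (fst A B) a ⊔ inverseImage (snd A B) b :=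
      le_top.trans (((hA.prod hB).mem_topOpen.1 hwtop).ge.trans hw)
    rcases rect_le_sup_iff.1 htop with hatop | hbtop
    · rw [top_le_iff.1 hatop] at ha
      exact le_sup_of_le_left (rect_top_le_iff.1 ha)
    · rw [top_le_iff.1 hbtop] at hb
      exact le_sup_of_le_right (rect_top_le_iff.1 hb)

end Compact

/-! ## Apartness and the Hausdorff property -/

section Apart

variable {X Y Z : Locale.{u}}

theorem diagonal_fst (X : Locale.{u}) : diagonal X ≫ fst X X = 𝟙 X :=
  lift_fst _ _

theorem diagonal_snd (X : Locale.{u}) : diagonal X ≫ snd X X = 𝟙 X :=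
  lift_snd _ _

theorem rect_le_diagonalCompl_iff {a b : X} : rect a b ≤ diagonalCompl X ↔ Disjoint a b := by
  rw [diagonalCompl, le_directImage_iff, inverseImage_rect, diagonal_fst, diagonal_snd,
    disjoint_iff_inf_le]
  exact Iff.rfl

/-- The open of `Y` on which the generalized points `f, g : Y ⟶ X` are apart, that is, the
inverse image along `(f, g)` of the complement of the diagonal. -/
def apart (f g : Y ⟶ X) : Y :=
  inverseImage (lift f g) (diagonalCompl X)

theorem inverseImage_apart (h : Z ⟶ Y) (f g : Y ⟶ X) :
    inverseImage h (apart f g) = apart (h ≫ f) (h ≫ g) := by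
  rw [apart, apart, ← inverseImage_comp, comp_lift]

theorem apart_fst_snd (X : Locale.{u}) : apart (fst X X) (snd X X) = diagonalCompl X := by
  rw [apart, lift_fst_snd]
  rfl

theorem inverseImage_diagonalCompl (h : Y ⟶ X ⊗ X) :
    inverseImage h (diagonalCompl X) = apart (h ≫ fst X X) (h ≫ snd X X) := by
  rw [← apart_fst_snd, inverseImage_apart]

theorem apart_le_iff {f g : Y ⟶ X} {c : Y} :
    apart f g ≤ c ↔ ∀ a b, Disjoint a b → inverseImage f a ⊓ inverseImage g b ≤ c := by
  simp only [apart, inverseImage_le_iff_forall_rect, rect_le_diagonalCompl_iff, inverseImage_rect,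
    lift_fst, lift_snd]

theorem inverseImage_inf_inverseImage_le_apart {a b : X} (h : Disjoint a b) (f g : Y ⟶ X) :
    inverseImage f a ⊓ inverseImage g b ≤ apart f g :=
  apart_le_iff.1 le_rfl a b h

theorem apart_self (f : Y ⟶ X) : apart f f = ⊥ :=
  le_bot_iff.1 <| apart_le_iff.2 fun a b h => by rw [← map_inf, h.eq_bot, map_bot]

theorem apart_comm (f g : Y ⟶ X) : apart f g = apart g f := by
  have hle : ∀ f g : Y ⟶ X, apart f g ≤ apart g f := fun f g => apart_le_iff.2 fun a b h => by
    rw [inf_comm]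
    exact inverseImage_inf_inverseImage_le_apart h.symm g f
  exact le_antisymm (hle f g) (hle g f)

theorem apart_comp_le (f g : Y ⟶ X) (k : X ⟶ Z) : apart (f ≫ k) (g ≫ k) ≤ apart f g :=
  apart_le_iff.2 fun a b h => by
    simpa only [inverseImage_comp] using
      inverseImage_inf_inverseImage_le_apart (h.map (inverseImage k)) f g

theorem inverseImage_le_sup_apart_of_fst_snd {a : X}
    (h : inverseImage (fst X X) a ≤ inverseImage (snd X X) a ⊔ diagonalCompl X) (f g : Y ⟶ X) :
    inverseImage f a ≤ inverseImage g a ⊔ apart f g := by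
  simpa only [map_sup, ← inverseImage_comp, lift_fst, lift_snd, apart]
    using inverseImage_mono (lift f g) h

theorem IsHausdorffLocale.inverseImage_le_sup_apart (hX : IsHausdorffLocale X) (f g : Y ⟶ X)
    (a : X) : inverseImage f a ≤ inverseImage g a ⊔ apart f g := by
  have hdirect : directImage (diagonal X) a = inverseImage (snd X X) a ⊔ diagonalCompl X := by
    have hfrobenius := hX.frobenius (inverseImage (snd X X) a) ⊥
    rwa [sup_bot_eq, ← inverseImage_comp, diagonal_snd] at hfrobenius
  refine inverseImage_le_sup_apart_of_fst_snd ?_ f g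
  rw [← hdirect, le_directImage_iff, ← inverseImage_comp, diagonal_fst]
  exact le_rfl

theorem inf_le_sup_of_disjoint {α : Type*} [DistribLattice α] [OrderBot α] {a b x y p q : α}
    (h : Disjoint a b) (hx : x ≤ a ⊔ p) (hy : y ≤ b ⊔ q) : x ⊓ y ≤ p ⊔ q :=
  calc x ⊓ y ≤ (a ⊔ (p ⊔ q)) ⊓ (b ⊔ (p ⊔ q)) :=
        inf_le_inf (hx.trans (sup_le_sup_left le_sup_left a))
          (hy.trans (sup_le_sup_left le_sup_right b))
    _ = p ⊔ q := by rw [← sup_inf_right, h.eq_bot, bot_sup_eq]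

theorem IsHausdorffLocale.apart_le_sup (hX : IsHausdorffLocale X) (f g h : Y ⟶ X) :
    apart f h ≤ apart f g ⊔ apart g h := by
  refine apart_le_iff.2 fun a b hab => ?_
  refine inf_le_sup_of_disjoint (hab.map (inverseImage g))
    (hX.inverseImage_le_sup_apart f g a) ?_
  rw [apart_comm]
  exact hX.inverseImage_le_sup_apart h g b

theorem inverseImage_fst_inverseImage_diagonal_le
    (h : ∀ a : X, inverseImage (fst X X) a ≤ inverseImage (snd X X) a ⊔ diagonalCompl X)
    (W : (X ⊗ X : Locale.{u})) :
    inverseImage (fst X X) (inverseImage (diagonal X) W) ≤ W ⊔ diagonalCompl X := by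
  refine inverseImage_le_sup_of_fst_snd (f := fst X X ≫ diagonal X) (g := 𝟙 _)
    (fun a => ?_) (fun a => ?_) W
  · rw [Category.assoc, diagonal_fst, Category.comp_id, Category.id_comp]
    exact le_sup_left
  · rw [Category.assoc, diagonal_snd, Category.comp_id, Category.id_comp]
    exact h a

theorem le_inverseImage_fst_inverseImage_diagonal_sup
    (h : ∀ a : X, inverseImage (fst X X) a ≤ inverseImage (snd X X) a ⊔ diagonalCompl X)
    (W : (X ⊗ X : Locale.{u})) :
    W ≤ inverseImage (fst X X) (inverseImage (diagonal X) W) ⊔ diagonalCompl X := by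
  refine inverseImage_le_sup_of_fst_snd (f := 𝟙 _) (g := fst X X ≫ diagonal X)
    (fun a => ?_) (fun a => ?_) W
  · rw [Category.assoc, diagonal_fst, Category.comp_id, Category.id_comp]
    exact le_sup_left
  · rw [Category.assoc, diagonal_snd, Category.comp_id, Category.id_comp, ← apart_fst_snd,
      apart_comm]
    exact inverseImage_le_sup_apart_of_fst_snd (h a) _ _

theorem directImage_diagonal_eq_sup
    (h : ∀ a : X, inverseImage (fst X X) a ≤ inverseImage (snd X X) a ⊔ diagonalCompl X) (a : X) :
    directImage (diagonal X) a = inverseImage (fst X X) a ⊔ diagonalCompl X := by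
  have hgc := gc_inverseImage_directImage (diagonal X)
  refine le_antisymm ?_ (sup_le ?_ (hgc.monotone_u bot_le))
  · refine (le_inverseImage_fst_inverseImage_diagonal_sup h _).trans ?_
    exact sup_le_sup_right (inverseImage_mono _ (hgc.l_u_le a)) _
  · rw [le_directImage_iff, ← inverseImage_comp, diagonal_fst]
    exact le_rfl

theorem isHausdorffLocale_of_inverseImage_fst_le
    (h : ∀ a : X, inverseImage (fst X X) a ≤ inverseImage (snd X X) a ⊔ diagonalCompl X) :
    IsHausdorffLocale X where
  directed s hs _ := by
    simp only [sSup_image, directImage_diagonal_eq_sup h, map_sSup]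
    exact biSup_sup hs
  frobenius W a := by
    have hgc := gc_inverseImage_directImage (diagonal X)
    refine le_antisymm ?_ (sup_le ?_ (hgc.monotone_u le_sup_right))
    · rw [directImage_diagonal_eq_sup h, directImage_diagonal_eq_sup h, map_sup]
      refine sup_le (sup_le ?_ (le_sup_left.trans le_sup_right)) (le_sup_right.trans le_sup_right)
      exact (inverseImage_fst_inverseImage_diagonal_le h W).trans (sup_le_sup_left le_sup_right W)
    · exact (hgc.le_u_l W).trans (hgc.monotone_u le_sup_left)

theorem IsHausdorffLocale.prod (hX : IsHausdorffLocale X) (hY : IsHausdorffLocale Y) :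
    IsHausdorffLocale (X ⊗ Y) := by
  refine isHausdorffLocale_of_inverseImage_fst_le fun W => ?_
  rw [← apart_fst_snd]
  exact inverseImage_le_sup_of_fst_snd
    (fun a => (hX.inverseImage_le_sup_apart _ _ a).trans (sup_le_sup_left (apart_comp_le _ _ _) _))
    (fun b => (hY.inverseImage_le_sup_apart _ _ b).trans (sup_le_sup_left (apart_comp_le _ _ _) _))
    W

theorem isHausdorffLocale_point : IsHausdorffLocale (𝟙_ Locale.{u}) :=
  isHausdorffLocale_of_inverseImage_fst_le fun _ => by
    rw [toUnit_unique (fst (𝟙_ Locale.{u}) (𝟙_ Locale.{u})) (snd _ _)]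
    exact le_sup_left

end Apart

/-! ## Regularity and local compactness -/

section LocallyCompact

open Topology.WithScott (toScott)

variable {X : Locale.{u}}

/-- `b` is well inside `a`: the closure of `b` is contained in `a`, the closure being the
complement of the largest open `z` disjoint from `b`. -/
def WellInside (b a : X) : Prop :=
  ∃ z, Disjoint b z ∧ Codisjoint z a

theorem WellInside.le {a b : X} (h : WellInside b a) : b ≤ a :=
  let ⟨_, hbz, hza⟩ := h
  hbz.le_of_codisjoint hza

theorem IsCompactHausdorff.le_sSup_wellInside (hX : IsCompactHausdorff X) (a : X) :
    a ≤ sSup {b | WellInside b a} := by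
  have ha : a ≤ directImage (fst X X) (inverseImage (snd X X) a ⊔ diagonalCompl X) := by
    rw [le_directImage_iff, ← apart_fst_snd]
    exact hX.hausdorff.inverseImage_le_sup_apart _ _ a
  rw [hX.compact.directImage_fst_eq_fiberMem] at ha
  refine ha.trans ((fiberMem_le_sSup_of_le_unionRect
    (L := fun x y => ∃ z, Disjoint x z ∧ y ≤ z ⊔ a) ?_ ?_ (sup_le ?_ ?_) _).trans (sSup_le ?_))
  · exact fun x => ⟨⊥, disjoint_bot_right, bot_le⟩
  · rintro x x' y y' ⟨z, hxz, hy⟩ ⟨z', hxz', hy'⟩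
    refine ⟨z ⊔ z', disjoint_sup_right.2 ⟨hxz.mono_left inf_le_left,
      hxz'.mono_left inf_le_right⟩, ?_⟩
    rw [sup_sup_distrib_right]
    exact sup_le_sup hy hy'
  · rw [← top_rect]
    exact rect_le_unionRect ⟨⊥, disjoint_bot_right, le_sup_right⟩
  · exact le_iff_forall_rect_le.2 fun x y hxy =>
      rect_le_unionRect ⟨y, rect_le_diagonalCompl_iff.1 hxy, le_sup_left⟩
  · rintro x ⟨y, ⟨z, hxz, hy⟩, hytop⟩
    exact le_sSup ⟨z, hxz, codisjoint_iff_le_sup.2 ((hX.compact.mem_topOpen.1 hytop).ge.trans hy)⟩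

/-- Local compactness of a locale, that is, continuity of its frame: every open `a` is the join of
the opens `b` way below it, here taken in the form that `a` belongs to a Scott open set of which
`b` is a lower bound. -/
def IsLocallyCompactLocale (X : Locale.{u}) : Prop :=
  ∀ a : X, a ≤ sSup {b | ∃ S : ScottOpens X, toScott a ∈ S ∧ b ∈ S.lowerBounds}

/-- For compact `X`, the Scott open set of those opens which contain the closure of `b`. -/
def IsCompactLocale.wellInsideOpen (hX : IsCompactLocale X) (b : X) : ScottOpens X :=
  ScottOpens.ofDirSupInacc {c | WellInside b c}
    (fun _ _ hcd ⟨z, hbz, hzc⟩ => ⟨z, hbz, hzc.mono_right hcd⟩) <| by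
    rintro D hD hdir c hc ⟨z, hbz, hzc⟩
    obtain ⟨d, hd, hdz⟩ := hX.topOpen.exists_sup_mem_of_isLUB (c := z) hD hdir hc
      (hX.mem_topOpen.2 hzc.symm.eq_top)
    exact ⟨d, hd, z, hbz, (codisjoint_iff.2 (hX.mem_topOpen.1 hdz)).symm⟩

theorem IsCompactHausdorff.isLocallyCompactLocale (hX : IsCompactHausdorff X) :
    IsLocallyCompactLocale X := fun a =>
  (hX.le_sSup_wellInside a).trans <| sSup_le_sSup fun b hb =>
    ⟨hX.compact.wellInsideOpen b, hb, fun _ hc => WellInside.le hc⟩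

end LocallyCompact

/-! ## Exponentiability of locally compact locales -/

section Exponential

open Topology.WithScott (toScott)

variable {X A : Locale.{u}}

/-- The locale whose opens are the Scott open sets of opens of `X`. For locally compact `X` it is
the exponential `𝕊^X`. -/
def powerLocale (X : Locale.{u}) : Locale.{u} :=
  Locale.of (ScottOpens X)

/-- The open of `powerLocale X × X` classified by evaluation, that is, `{(c, x) | x ∈ c}`. -/
def evOpen (X : Locale.{u}) : (powerLocale X ⊗ X : Locale.{u}) :=
  unionRect fun S b => b ∈ ScottOpens.lowerBounds S

/-- The inverse image map of the morphism `A ⟶ 𝕊^X` classifying the open `W` of `A × X`. -/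
def powerDesc (W : (A ⊗ X : Locale.{u})) : FrameHom (ScottOpens X) A where
  toFun := fiberMem W
  map_inf' S T := by
    refine le_antisymm (fiberMem_le_iff.2 fun a b hb hab =>
      le_inf (le_fiberMem hb.1 hab) (le_fiberMem hb.2 hab)) ?_
    rw [fiberMem, fiberMem, sSup_inf_sSup]
    refine iSup₂_le ?_
    rintro ⟨a, a'⟩ ⟨⟨b, hb, hab⟩, b', hb', hab'⟩
    exact le_fiberMem ⟨S.mem_of_le le_sup_left hb, T.mem_of_le le_sup_right hb'⟩
      (rect_inf_sup_le hab hab')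
  map_top' := top_le_iff.1 (le_fiberMem (b := ⊥) trivial (rect_bot_le _ _))
  map_sSup' s := by
    refine le_antisymm (fiberMem_le_iff.2 fun a b hb hab => ?_)
      (sSup_le (Set.forall_mem_image.2 fun S hS => fiberMem_le_iff.2 fun a b hb hab => ?_))
    · obtain ⟨S, hS, hbS⟩ := TopologicalSpace.Opens.mem_sSup.1 hb
      exact (le_fiberMem hbS hab).trans (le_sSup ⟨S, hS, rfl⟩)
    · exact le_fiberMem (TopologicalSpace.Opens.mem_sSup.2 ⟨S, hS, hb⟩) hab

/-- The morphism `A ⟶ 𝕊^X` classifying the open `W` of `A × X`. -/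
def powerHom (W : (A ⊗ X : Locale.{u})) : A ⟶ powerLocale X :=
  ofFrameHom (powerDesc W)

theorem inverseImage_powerHom (W : (A ⊗ X : Locale.{u})) (S : powerLocale X) :
    inverseImage (powerHom W) S = fiberMem W S :=
  rfl

theorem rect_fiberMem_le (W : (A ⊗ X : Locale.{u})) {S : ScottOpens X} {b : X}
    (hb : b ∈ S.lowerBounds) : rect (fiberMem W S) b ≤ W := by
  refine rect_sSup_left_le ?_
  rintro a ⟨c, hc, hac⟩
  exact (rect_mono le_rfl (hb c hc)).trans hac

theorem IsLocallyCompactLocale.inverseImage_powerHom_evOpen (hX : IsLocallyCompactLocale X)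
    (W : (A ⊗ X : Locale.{u})) : inverseImage (powerHom W ▷ X) (evOpen X) = W := by
  refine le_antisymm (inverseImage_unionRect_le_iff.2 fun S b hb => ?_)
    (le_iff_forall_rect_le.2 fun a b hab => ?_)
  · rw [inverseImage_whiskerRight_rect, inverseImage_powerHom]
    exact rect_fiberMem_le W hb
  · refine (rect_mono le_rfl (hX b)).trans (rect_sSup_right_le ?_)
    rintro c ⟨S, hbS, hcS⟩
    refine (rect_mono (le_fiberMem hbS hab) le_rfl).trans ?_
    exact (inverseImage_whiskerRight_rect (powerHom W) S c).ge.trans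
      (inverseImage_mono _ (rect_le_unionRect hcS))

theorem IsLocallyCompactLocale.exists_mem_lowerBounds (hX : IsLocallyCompactLocale X)
    {S : ScottOpens X} {a : X} (ha : toScott a ∈ S) :
    ∃ (T : ScottOpens X) (b : X), toScott a ∈ T ∧ b ∈ T.lowerBounds ∧ toScott b ∈ S := by
  let D : Set X := {b | ∃ T : ScottOpens X, toScott a ∈ T ∧ b ∈ T.lowerBounds}
  have hne : D.Nonempty := ⟨⊥, ⊤, trivial, ScottOpens.bot_mem_lowerBounds _⟩
  have hdir : DirectedOn (· ≤ ·) D := fun b ⟨T, haT, hb⟩ b' ⟨T', haT', hb'⟩ =>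
    ⟨b ⊔ b', ⟨T ⊓ T', ⟨haT, haT'⟩, ScottOpens.sup_mem_lowerBounds_inf hb hb'⟩, le_sup_left,
      le_sup_right⟩
  have hlub : IsLUB D a := ⟨fun b ⟨_, haT, hb⟩ => hb a haT, fun _ hc => (hX a).trans (sSup_le hc)⟩
  obtain ⟨b, ⟨T, haT, hb⟩, hbS⟩ := S.exists_mem_of_isLUB hne hdir hlub ha
  exact ⟨T, b, haT, hb, hbS⟩

theorem IsLocallyCompactLocale.fiberMem_evOpen (hX : IsLocallyCompactLocale X)
    (S : powerLocale X) : fiberMem (evOpen X) S = S := by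
  refine le_antisymm ?_ fun a ha => ?_
  · refine (fiberMem_le_sSup_of_le_unionRect (A := powerLocale X)
      (fun T => ScottOpens.bot_mem_lowerBounds T) ScottOpens.sup_mem_lowerBounds_inf le_rfl
        S).trans (sSup_le ?_)
    rintro T ⟨b, hb, hbS⟩ a ha
    exact ScottOpens.mem_of_le S (hb a ha) hbS
  · obtain ⟨T, b, haT, hb, hbS⟩ := hX.exists_mem_lowerBounds ha
    exact le_fiberMem (A := powerLocale X) hbS (rect_le_unionRect hb) haT

theorem IsLocallyCompactLocale.powerHom_inverseImage_evOpen (hX : IsLocallyCompactLocale X)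
    (f : A ⟶ powerLocale X) : powerHom (inverseImage (f ▷ X) (evOpen X)) = f :=
  locale_hom_ext fun S => (fiberMem_inverseImage_whiskerRight f (evOpen X) S).trans
    (congrArg (inverseImage f) (hX.fiberMem_evOpen S))

theorem opensEquiv_comp {A B : Locale.{u}} (f : A ⟶ B) (g : B ⟶ sierpinski) :
    opensEquiv A (f ≫ g) = inverseImage f (opensEquiv B g) :=
  rfl

theorem IsLocallyCompactLocale.nonempty_sierpinskiPower (hX : IsLocallyCompactLocale X) :
    Nonempty (SierpinskiPower X) := by
  refine ⟨⟨powerLocale X, (opensEquiv _).symm (evOpen X), fun A f =>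
    ⟨powerHom (opensEquiv _ f), (opensEquiv _).injective ?_, fun g hg => ?_⟩⟩⟩
  · change opensEquiv _ (_ ≫ _) = _
    rw [opensEquiv_comp, Equiv.apply_symm_apply, hX.inverseImage_powerHom_evOpen]
  · rw [← hg, opensEquiv_comp, Equiv.apply_symm_apply, hX.powerHom_inverseImage_evOpen]

end Exponential

theorem IsCompactHausdorff.prod {X Y : Locale.{u}} (hX : IsCompactHausdorff X)
    (hY : IsCompactHausdorff Y) : IsCompactHausdorff (X ⊗ Y) :=
  ⟨hX.compact.prod hY.compact, hX.hausdorff.prod hY.hausdorff⟩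

theorem isCompactHausdorff_point : IsCompactHausdorff (𝟙_ Locale.{u}) :=
  ⟨isCompactLocale_point, isHausdorffLocale_point⟩

theorem IsCompactHausdorff.nonempty_sierpinskiPower {X : Locale.{u}} (hX : IsCompactHausdorff X) :
    Nonempty (SierpinskiPower X) :=
  hX.isLocallyCompactLocale.nonempty_sierpinskiPower

/-! ## Opens classified by morphisms to an exponential -/

theorem whiskerRight_le_whiskerRight {A B : Locale.{u}} {f g : A ⟶ B} (h : f ≤ g)
    (C : Locale.{u}) : f ▷ C ≤ g ▷ C := by
  simp only [hom_le_iff, whiskerRight_fst, whiskerRight_snd]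
  exact ⟨comp_le_comp le_rfl h, le_rfl⟩

section InsertOpen

variable {A X : Locale.{u}}

/-- The morphism `A ⟶ A × 𝕊` with second component the classifying map of `a`. The insertions of
`⊥` and `⊤` are the ends of a cylinder on `A`, and `A × 𝕊` serves as a directed interval. -/
def insertOpen (a : A) : A ⟶ A ⊗ sierpinski :=
  lift (𝟙 A) ((opensEquiv A).symm a)

theorem insertOpen_mono : Monotone (insertOpen (A := A)) := fun a b hab => by
  simp only [insertOpen, hom_le_iff, lift_fst, lift_snd]
  exact ⟨le_rfl, fun _ => sup_le_sup_left (iSup_mono fun _ => hab) _⟩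

theorem exists_inverseImage_insertOpen_eq (U V : (A ⊗ X : Locale.{u})) :
    ∃ W : ((A ⊗ sierpinski) ⊗ X : Locale.{u}), ∀ a,
      inverseImage (insertOpen a ▷ X) W = U ⊔ V ⊓ inverseImage (fst A X) a := by
  have hfst (a : A) (V : (A ⊗ X : Locale.{u})) :
      inverseImage (insertOpen a ▷ X) (inverseImage (fst A sierpinski ▷ X) V) = V := by
    rw [← inverseImage_comp, ← comp_whiskerRight, insertOpen, lift_fst, id_whiskerRight]
    rfl
  have hsnd (a : A) : inverseImage (insertOpen a ▷ X)
      (inverseImage (fst _ X) (inverseImage (snd A sierpinski) genericOpen)) =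
        inverseImage (fst A X) a := by
    rw [← inverseImage_comp, whiskerRight_fst, inverseImage_comp,
      ← inverseImage_comp (insertOpen a), insertOpen, lift_snd]
    exact congrArg _ ((opensEquiv A).apply_symm_apply a)
  refine ⟨inverseImage (fst A sierpinski ▷ X) U ⊔ inverseImage (fst A sierpinski ▷ X) V ⊓
    inverseImage (fst _ X) (inverseImage (snd A sierpinski) genericOpen), fun a => ?_⟩
  rw [map_sup, map_inf, hfst, hfst, hsnd]

end InsertOpen

namespace SierpinskiPower

variable {X Y A B : Locale.{u}}

theorem classified_comp (E : SierpinskiPower X) (f : A ⟶ B) (g : B ⟶ E.obj) :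
    E.classified (f ≫ g) = inverseImage (f ▷ X) (E.classified g) := by
  rw [classified, untranspose, comp_whiskerRight, Category.assoc]
  rfl

theorem untranspose_transpose (E : SierpinskiPower X) (f : A ⊗ X ⟶ sierpinski) :
    E.untranspose (E.transpose f) = f :=
  (E.existsUnique_transpose A f).choose_spec.1

theorem classified_transpose (E : SierpinskiPower X) (f : A ⊗ X ⟶ sierpinski) :
    E.classified (E.transpose f) = opensEquiv _ f := by
  rw [classified, untranspose_transpose]

theorem classified_injective (E : SierpinskiPower X) :
    Function.Injective (E.classified (A := A)) := fun _ h hgh =>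
  (E.existsUnique_transpose A (E.untranspose h)).unique ((opensEquiv _).injective hgh) rfl

theorem le_iff_classified_le (E : SierpinskiPower X) {g h : A ⟶ E.obj} :
    g ≤ h ↔ E.classified g ≤ E.classified h := by
  refine ⟨fun hgh => whiskerRight_le_whiskerRight hgh X _, fun hgh => ?_⟩
  obtain ⟨W, hW⟩ := exists_inverseImage_insertOpen_eq (E.classified g) (E.classified h)
  let H : A ⊗ sierpinski ⟶ E.obj := E.transpose ((opensEquiv _).symm W)
  have hH (a : A) : E.classified (insertOpen a ≫ H) =
      E.classified g ⊔ E.classified h ⊓ inverseImage (fst A X) a := by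
    rw [classified_comp, classified_transpose, Equiv.apply_symm_apply, hW]
  have hbot : insertOpen ⊥ ≫ H = g :=
    E.classified_injective (by rw [hH, map_bot, inf_bot_eq, sup_bot_eq])
  have htop : insertOpen ⊤ ≫ H = h :=
    E.classified_injective (by rw [hH, map_top, inf_top_eq, sup_eq_right.2 hgh])
  rw [← hbot, ← htop]
  exact comp_le_comp (insertOpen_mono bot_le) le_rfl

theorem classified_comp_map (E : SierpinskiPower X) (F : SierpinskiPower Y) (φ : Y ⟶ X)
    (h : A ⟶ E.obj) :
    F.classified (h ≫ E.map F φ) = inverseImage (A ◁ φ) (E.classified h) := by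
  rw [classified_comp, map, classified_transpose, opensEquiv_comp, ← inverseImage_comp,
    ← whisker_exchange, inverseImage_comp]
  rfl

theorem classified_join (E : SierpinskiPower X) (g h : A ⟶ E.obj) :
    E.classified (E.join g h) = E.classified g ⊔ E.classified h := by
  rw [join, classified_transpose, opensEquiv_comp, sierpinskiJoin, Equiv.apply_symm_apply,
    map_sup, ← inverseImage_comp, ← inverseImage_comp, lift_fst, lift_snd]
  rfl

theorem classified_bot (E : SierpinskiPower X) : E.classified E.bot = ⊥ := by
  rw [bot, classified_transpose, opensEquiv_comp, sierpinskiBot, Equiv.apply_symm_apply, map_bot]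

theorem classified_singletonMap (E : SierpinskiPower X) :
    E.classified (singletonMap E) = diagonalCompl X := by
  rw [singletonMap, classified_transpose, diagonalMap, Equiv.apply_symm_apply]

theorem classified_diagonalPoint (F : SierpinskiPower (X ⊗ X)) :
    F.classified (diagonalPoint F) = inverseImage (snd _ (X ⊗ X)) (diagonalCompl X) := by
  rw [diagonalPoint, classified_transpose, opensEquiv_comp, diagonalMap, Equiv.apply_symm_apply,
    leftUnitor_hom]

end SierpinskiPower

/-! ## Images of closed sublocales along `A × X ⟶ A × 1` -/

section Image

variable {A B X : Locale.{u}}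

theorem inverseImage_inv_le_iff (e : A ≅ B) {a : A} {b : B} :
    inverseImage e.inv a ≤ b ↔ a ≤ inverseImage e.hom b := by
  constructor <;> intro h
  · simpa only [← inverseImage_comp, e.hom_inv_id, inverseImage_id] using inverseImage_mono e.hom h
  · simpa only [← inverseImage_comp, e.inv_hom_id, inverseImage_id] using inverseImage_mono e.inv h

theorem directImage_whiskerLeft_toUnit (W : (A ⊗ X : Locale.{u})) :
    directImage (A ◁ toUnit X) W =
      inverseImage (fst A (𝟙_ Locale.{u})) (directImage (fst A X) W) := by
  have hfst : A ◁ toUnit X = fst A X ≫ (ρ_ A).inv := by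
    rw [Iso.eq_comp_inv, rightUnitor_hom, whiskerLeft_fst]
  refine eq_of_forall_le_iff fun v => ?_
  rw [← rightUnitor_hom, ← inverseImage_inv_le_iff, le_directImage_iff, le_directImage_iff, hfst,
    inverseImage_comp]

/-- The right adjoint `𝕊^X ⟶ 𝕊^1` of `𝕊^!`. It classifies the image in `𝕊^X × 1` of the generic
closed sublocale of `𝕊^X × X`. -/
noncomputable def imageMap (E : SierpinskiPower X) (G : SierpinskiPower (𝟙_ Locale.{u})) :
    E.obj ⟶ G.obj :=
  G.transpose ((opensEquiv _).symm (directImage (E.obj ◁ toUnit X) (opensEquiv _ E.ev)))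

theorem classified_comp_imageMap (hX : IsCompactLocale X) (E : SierpinskiPower X)
    (G : SierpinskiPower (𝟙_ Locale.{u})) (h : A ⟶ E.obj) :
    G.classified (h ≫ imageMap E G) = directImage (A ◁ toUnit X) (E.classified h) := by
  have hev : E.classified h = inverseImage (h ▷ X) (opensEquiv _ E.ev) := rfl
  rw [G.classified_comp, imageMap, G.classified_transpose, Equiv.apply_symm_apply,
    directImage_whiskerLeft_toUnit, directImage_whiskerLeft_toUnit, hev,
    hX.directImage_fst_inverseImage_whiskerRight, ← inverseImage_comp, ← inverseImage_comp,
    whiskerRight_fst]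

theorem isRightAdjointOf_imageMap (hX : IsCompactLocale X) (E : SierpinskiPower X)
    (G : SierpinskiPower (𝟙_ Locale.{u})) :
    IsRightAdjointOf (imageMap E G) (G.map E (toUnit X)) where
  unit := by
    rw [G.le_iff_classified_le, classified_comp_imageMap hX, le_directImage_iff,
      ← G.classified_comp_map, Category.id_comp]
  counit := by
    rw [E.le_iff_classified_le, G.classified_comp_map, ← le_directImage_iff,
      ← classified_comp_imageMap hX, Category.id_comp]

end Image

/-! ## Graphs of morphisms and the inserter -/

section Graph

variable {A X : Locale.{u}}

/-- The complement of the graph of `f`, as an open of `A × X`: the graph is the inverse image of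
the closed diagonal along `f × X`. -/
def graphCompl (f : A ⟶ X) : (A ⊗ X : Locale.{u}) :=
  inverseImage (f ▷ X) (diagonalCompl X)

theorem graphCompl_eq_apart (f : A ⟶ X) : graphCompl f = apart (fst A X ≫ f) (snd A X) := by
  rw [graphCompl, inverseImage_diagonalCompl, whiskerRight_fst, whiskerRight_snd]

theorem inverseImage_lift_graphCompl (f g : A ⟶ X) :
    inverseImage (lift (𝟙 A) g) (graphCompl f) = apart f g := by
  rw [graphCompl_eq_apart, inverseImage_apart, lift_fst_assoc, Category.id_comp, lift_snd]

theorem IsHausdorffLocale.graphCompl_le_graphCompl_iff (hX : IsHausdorffLocale X) {f g : A ⟶ X} :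
    graphCompl f ≤ graphCompl g ↔ f ≤ g := by
  refine ⟨fun h a => ?_, fun h => whiskerRight_le_whiskerRight h X _⟩
  have hapart : apart f g ≤ ⊥ := by
    rw [← apart_self g, ← inverseImage_lift_graphCompl f g, ← inverseImage_lift_graphCompl g g]
    exact inverseImage_mono _ h
  exact (hX.inverseImage_le_sup_apart f g a).trans (sup_le le_rfl (hapart.trans bot_le))

/-- The closed sublocale of `A × X` with open complement `W` is a functional relation: any two
points of `X` related to the same point of `A` agree, and the sublocale maps onto `A`. Both
conditions are stated on complements. -/
structure IsFunctional (W : (A ⊗ X : Locale.{u})) : Prop where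
  singleValued : inverseImage (snd A (X ⊗ X)) (diagonalCompl X) ≤
    inverseImage (A ◁ fst X X) W ⊔ inverseImage (A ◁ snd X X) W
  total : directImage (fst A X) W = ⊥

theorem IsHausdorffLocale.isFunctional_diagonalCompl (hX : IsHausdorffLocale X) :
    IsFunctional (diagonalCompl X) where
  singleValued := by
    simp only [inverseImage_diagonalCompl, whiskerLeft_fst, whiskerLeft_snd]
    rw [apart_comm (fst X (X ⊗ X)) (snd X (X ⊗ X) ≫ fst X X)]
    exact hX.apart_le_sup _ _ _
  total := by
    have h := inverseImage_mono (diagonal X)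
      ((gc_inverseImage_directImage (fst X X)).l_u_le (diagonalCompl X))
    rwa [← inverseImage_comp, diagonal_fst, inverseImage_id, inverseImage_diagonalCompl,
      diagonal_fst, diagonal_snd, apart_self, le_bot_iff] at h

/-- The open of those points of `A` all of whose related points lie in `x`, for the closed
relation from `A` to `X` with complement `W`; compare `SetRel.core`. -/
def core (W : (A ⊗ X : Locale.{u})) (x : X) : A :=
  directImage (fst A X) (W ⊔ inverseImage (snd A X) x)

theorem le_core_iff {W : (A ⊗ X : Locale.{u})} {a : A} {x : X} :
    a ≤ core W x ↔ inverseImage (fst A X) a ≤ W ⊔ inverseImage (snd A X) x :=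
  le_directImage_iff _ _ _

theorem inverseImage_fst_core_le (W : (A ⊗ X : Locale.{u})) (x : X) :
    inverseImage (fst A X) (core W x) ≤ W ⊔ inverseImage (snd A X) x :=
  le_core_iff.1 le_rfl

theorem core_mono (W : (A ⊗ X : Locale.{u})) : Monotone (core W) := fun _ _ h =>
  (gc_inverseImage_directImage _).monotone_u (sup_le_sup_left (inverseImage_mono _ h) W)

theorem core_inf (W : (A ⊗ X : Locale.{u})) (x y : X) : core W (x ⊓ y) = core W x ⊓ core W y := by
  rw [core, map_inf, sup_inf_left, (gc_inverseImage_directImage _).u_inf]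
  rfl

theorem core_top (W : (A ⊗ X : Locale.{u})) : core W ⊤ = ⊤ := by
  rw [core, map_top, sup_top_eq, (gc_inverseImage_directImage _).u_top]

theorem IsFunctional.core_bot {W : (A ⊗ X : Locale.{u})} (hW : IsFunctional W) : core W ⊥ = ⊥ := by
  rw [core, map_bot, sup_bot_eq, hW.total]

theorem IsCompactLocale.core_sSup (hX : IsCompactLocale X) (W : (A ⊗ X : Locale.{u})) {s : Set X}
    (hs : s.Nonempty) (hd : DirectedOn (· ≤ ·) s) : core W (sSup s) = sSup (core W '' s) := by
  have hsup : W ⊔ inverseImage (snd A X) (sSup s) =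
      sSup ((fun x => W ⊔ inverseImage (snd A X) x) '' s) := by
    rw [map_sSup, sSup_image, sSup_image, sup_biSup hs]
  have hdir : DirectedOn (· ≤ ·) ((fun x => W ⊔ inverseImage (snd A X) x) '' s) :=
    directedOn_image.2 (hd.mono fun _ _ h => sup_le_sup_left (inverseImage_mono _ h) W)
  rw [core, hsup, hX.directImage_fst_sSup (hs.image _) hdir, Set.image_image]
  rfl

theorem IsFunctional.core_sup_le {W : (A ⊗ X : Locale.{u})} (hW : IsFunctional W)
    (hX : IsCompactHausdorff X) (x y : X) : core W (x ⊔ y) ≤ core W x ⊔ core W y := by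
  refine le_directImage_sup_directImage hX.compact hX.compact ?_
  let f : A ⊗ (X ⊗ X) ⟶ X := snd A (X ⊗ X) ≫ fst X X
  let g : A ⊗ (X ⊗ X) ⟶ X := snd A (X ⊗ X) ≫ snd X X
  have hcore := inverseImage_mono (A ◁ fst X X) (inverseImage_fst_core_le W (x ⊔ y))
  have hy : inverseImage f y ≤ inverseImage g y ⊔ apart f g :=
    hX.hausdorff.inverseImage_le_sup_apart f g y
  have hfg : apart f g ≤ inverseImage (A ◁ fst X X) W ⊔ inverseImage (A ◁ snd X X) W := by
    rw [← inverseImage_diagonalCompl]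
    exact hW.singleValued
  simp only [map_sup, ← inverseImage_comp, whiskerLeft_fst, whiskerLeft_snd] at hcore ⊢
  refine hcore.trans (sup_le (le_sup_of_le_left le_sup_left)
    (sup_le (le_sup_of_le_left le_sup_right) (hy.trans (sup_le ?_ (hfg.trans ?_)))))
  · exact le_sup_of_le_right le_sup_right
  · exact sup_le_sup le_sup_left le_sup_left

/-- The inverse image map of the morphism `A ⟶ X` whose graph has complement `W`. -/
def IsFunctional.frameHom {W : (A ⊗ X : Locale.{u})} (hW : IsFunctional W)
    (hX : IsCompactHausdorff X) : FrameHom X A where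
  toFun := core W
  map_inf' := core_inf W
  map_top' := core_top W
  map_sSup' s := by
    refine le_antisymm ?_ (sSup_le (Set.forall_mem_image.2 fun x hx => core_mono W (le_sSup hx)))
    refine sSup_mem_of_supClosed_of_dirSupClosed (s := {x | core W x ≤ sSup (core W '' s)})
      (hW.core_bot.trans_le bot_le) (fun x hx y hy => (hW.core_sup_le hX x y).trans (sup_le hx hy))
      (fun t ht hne hdir x hx => ?_) fun x hx => le_sSup ⟨x, hx, rfl⟩
    rw [← hx.sSup_eq]
    exact (hX.compact.core_sSup W hne hdir).trans_le (sSup_le (Set.forall_mem_image.2 ht))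

/-- The morphism `A ⟶ X` whose graph has complement `W`. -/
def IsFunctional.hom {W : (A ⊗ X : Locale.{u})} (hW : IsFunctional W)
    (hX : IsCompactHausdorff X) : A ⟶ X :=
  ofFrameHom (hW.frameHom hX)

theorem IsFunctional.inverseImage_hom {W : (A ⊗ X : Locale.{u})} (hW : IsFunctional W)
    (hX : IsCompactHausdorff X) (x : X) : inverseImage (hW.hom hX) x = core W x :=
  rfl

theorem IsFunctional.disjoint_core_of_rect_le {W : (A ⊗ X : Locale.{u})} (hW : IsFunctional W)
    {a : A} {x : X} (h : rect a x ≤ W) : Disjoint a (core W x) := by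
  rw [disjoint_iff_inf_le, ← hW.total, le_directImage_iff, map_inf]
  refine (inf_le_inf_left _ (inverseImage_fst_core_le W x)).trans ?_
  rw [inf_sup_left]
  exact sup_le inf_le_right h

theorem IsFunctional.graphCompl_hom {W : (A ⊗ X : Locale.{u})} (hW : IsFunctional W)
    (hX : IsCompactHausdorff X) : graphCompl (hW.hom hX) = W := by
  rw [graphCompl_eq_apart]
  refine le_antisymm (apart_le_iff.2 fun x y hxy => ?_) (le_iff_forall_rect_le.2 fun a x hax => ?_)
  · rw [inverseImage_comp, hW.inverseImage_hom]
    refine (inf_le_inf_right _ (inverseImage_fst_core_le W x)).trans ?_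
    rw [inf_sup_right, ← map_inf, hxy.eq_bot, map_bot, sup_bot_eq]
    exact inf_le_left
  · have hdisj : Disjoint (inverseImage (fst A X) a) (inverseImage (fst A X ≫ hW.hom hX) x) :=
      (hW.disjoint_core_of_rect_le hax).map (inverseImage (fst A X))
    have hx := hX.hausdorff.inverseImage_le_sup_apart (snd A X) (fst A X ≫ hW.hom hX) x
    rw [apart_comm] at hx
    refine (inf_le_inf_left _ hx).trans ?_
    rw [inf_sup_left, hdisj.eq_bot, bot_sup_eq]
    exact inf_le_right

end Graph

section Inserter

variable {A X : Locale.{u}}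

theorem comp_lift_le_comp_lift_iff_isFunctional (hX : IsCompactLocale X) (E : SierpinskiPower X)
    (F : SierpinskiPower (X ⊗ X)) (G : SierpinskiPower (𝟙_ Locale.{u})) (h : A ⟶ E.obj) :
    h ≫ lift (toUnit E.obj ≫ diagonalPoint F) (imageMap E G) ≤
      h ≫ lift (F.join (E.map F (fst X X)) (E.map F (snd X X))) (toUnit E.obj ≫ G.bot) ↔
    IsFunctional (E.classified h) := by
  have hdiagonal : F.classified (h ≫ toUnit E.obj ≫ diagonalPoint F) =
      inverseImage (snd A (X ⊗ X)) (diagonalCompl X) := by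
    rw [← Category.assoc, F.classified_comp, F.classified_diagonalPoint, ← inverseImage_comp,
      whiskerRight_snd]
  have hjoin : F.classified (h ≫ F.join (E.map F (fst X X)) (E.map F (snd X X))) =
      inverseImage (A ◁ fst X X) (E.classified h) ⊔
        inverseImage (A ◁ snd X X) (E.classified h) := by
    rw [F.classified_comp, F.classified_join, map_sup, ← F.classified_comp, ← F.classified_comp,
      E.classified_comp_map, E.classified_comp_map]
  have hbot : G.classified (h ≫ toUnit E.obj ≫ G.bot) = ⊥ := by
    rw [← Category.assoc, G.classified_comp, G.classified_bot, map_bot]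
  have htotal : inverseImage (fst A (𝟙_ Locale.{u})) (directImage (fst A X) (E.classified h)) ≤ ⊥ ↔
      directImage (fst A X) (E.classified h) = ⊥ := by
    rw [← rightUnitor_hom, ← Iso.symm_inv, inverseImage_inv_le_iff, map_bot, le_bot_iff]
  rw [hom_le_iff]
  simp only [Category.assoc, lift_fst, lift_snd, F.le_iff_classified_le, G.le_iff_classified_le]
  rw [hdiagonal, hjoin, hbot, classified_comp_imageMap hX, directImage_whiskerLeft_toUnit, htotal]
  exact ⟨fun h => ⟨h.1, h.2⟩, fun h => ⟨h.1, h.2⟩⟩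

theorem classified_comp_singletonMap (E : SierpinskiPower X) (k : A ⟶ X) :
    E.classified (k ≫ singletonMap E) = graphCompl k := by
  rw [E.classified_comp, E.classified_singletonMap, graphCompl]

theorem IsHausdorffLocale.comp_singletonMap_le_iff (hX : IsHausdorffLocale X)
    (E : SierpinskiPower X) {k k' : A ⟶ X} :
    k ≫ singletonMap E ≤ k' ≫ singletonMap E ↔ k ≤ k' := by
  rw [E.le_iff_classified_le, classified_comp_singletonMap, classified_comp_singletonMap,
    hX.graphCompl_le_graphCompl_iff]

theorem isInserter_singletonMap (hX : IsCompactHausdorff X) (E : SierpinskiPower X)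
    (F : SierpinskiPower (X ⊗ X)) (G : SierpinskiPower (𝟙_ Locale.{u})) :
    IsInserter (singletonMap E) (lift (toUnit E.obj ≫ diagonalPoint F) (imageMap E G))
      (lift (F.join (E.map F (fst X X)) (E.map F (snd X X))) (toUnit E.obj ≫ G.bot)) where
  condition := by
    rw [comp_lift_le_comp_lift_iff_isFunctional hX.compact, E.classified_singletonMap]
    exact hX.hausdorff.isFunctional_diagonalCompl
  existsUnique_lift A h hh := by
    rw [comp_lift_le_comp_lift_iff_isFunctional hX.compact] at hh
    have hlift : hh.hom hX ≫ singletonMap E = h := E.classified_injective <| by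
      rw [classified_comp_singletonMap, hh.graphCompl_hom]
    refine ⟨hh.hom hX, hlift, fun k hk => le_antisymm ?_ ?_⟩ <;>
      rw [← hX.hausdorff.comp_singletonMap_le_iff E, hk, hlift]
  le_of_comp_le _ _ _ := (hX.hausdorff.comp_singletonMap_le_iff E).1

end Inserter

end CompactHausdorffLocale

open CompactHausdorffLocale in
theorem mainTheorem8 (X : Locale.{u}) (hX : IsCompactHausdorff X) :
    (IsCompactHausdorff (X ⊗ X) ∧ IsCompactHausdorff (𝟙_ Locale.{u})) ∧
    (Nonempty (SierpinskiPower X) ∧ Nonempty (SierpinskiPower (X ⊗ X)) ∧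
      Nonempty (SierpinskiPower (𝟙_ Locale.{u}))) ∧
    ∀ (E : SierpinskiPower X) (F : SierpinskiPower (X ⊗ X)) (G : SierpinskiPower (𝟙_ Locale.{u})),
      ∃ r : E.obj ⟶ G.obj,
        IsRightAdjointOf r (G.map E (toUnit X)) ∧
        (∀ (A : Locale.{u}) (h : A ⟶ E.obj),
          G.classified (h ≫ r) = directImage (A ◁ toUnit X) (E.classified h)) ∧
        IsInserter (singletonMap E)
          (lift (toUnit E.obj ≫ diagonalPoint F) r)
          (lift (F.join (E.map F (fst X X)) (E.map F (snd X X))) (toUnit E.obj ≫ G.bot)) :=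
  ⟨⟨hX.prod hX, isCompactHausdorff_point⟩,
    ⟨hX.nonempty_sierpinskiPower, (hX.prod hX).nonempty_sierpinskiPower,
      isCompactHausdorff_point.nonempty_sierpinskiPower⟩,
    fun E F G => ⟨imageMap E G, isRightAdjointOf_imageMap hX.compact E G,
      fun _ h => classified_comp_imageMap hX.compact E G h, isInserter_singletonMap hX E F G⟩⟩
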